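/- Let $(X,\mu)$ be a measure space, let $K:X\times X\to\mathbb{C}$ be a positive definite kernel with reproducing kernel Hilbert space $\mathscr{H}_K$, and suppose that the pair $(K,\mu)$ is admissible, i.e. $K(\cdot,y)\in L^2(\mu)$ for all $y\in X$ and the map $\mathscr{H}_K\ni K(\cdot,y)\mapsto K(\cdot,y)\in L^2(\mu)$, extended by linearity to the span of the functions $K(\cdot,y)$, is well defined and closable. Let $T=T_{\mu,K}$ (from $\mathscr{H}_K$ to $L^2(\mu)$) be its closure, and let $\alpha>0$. Then $TT^*$, on its natural domain, is a (possibly unbounded) self-adjoint operator in $L^2(\mu)$; it has a spectral measure, i.e. a projection-valued Borel measure $Q$, with $TT^*=\int x\,Q(dx)$, and every such $Q$ is concentrated on $[0,\infty)$; it has a positive self-adjoint square root $(TT^*)^{1/2}$; and $\alpha+TT^*$ is a bijection from the domain of $TT^*$ onto $L^2(\mu)$. For every $\varphi\in L^2(\mu)$ the element $f^{\varphi,K}:=T^*(\alpha+TT^*)^{-1}\varphi$ of $\mathscr{H}_K$ is defined and belongs to the domain of $T$, and (with all terms defined and all integrals convergent) $$\|f^{\varphi,K}\|_{\mathscr{H}_K}^2=\left\langle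 \varphi,\,TT^*(\alpha+TT^*)^{-2}\varphi\right\rangle_{L^2(\mu)}=\left\|(TT^*)^{1/2}(\alpha+TT^*)^{-1}\varphi\right\|_{L^2(\mu)}^2=\int_{[0,\infty)}\frac{x}{(\alpha+x)^2}\,\|Q(dx)\varphi\|_{L^2(\mu)}^2 .$$ Moreover, let $W_Kh=(h,Th)$ for $h$ in the domain of $T$, where $\mathscr{H}_K\times L^2(\mu)$ carries the inner product $\langle(u_1,v_1),(u_2,v_2)\rangle=\alpha\langle u_1,u_2\rangle_{\mathscr{H}_K}+\langle v_1,v_2\rangle_{L^2(\mu)}$. Then $$\|W_Kf^{\varphi,K}\|_{\mathscr{H}_K\times L^2(\mu)}^2=\int_{[0,\infty)}\frac{x}{\alpha+x}\,\|Q(dx)\varphi\|_{L^2(\mu)}^2\le\|\varphi\|_{L^2(\mu)}^2 .$$ Here $\|Q(dx)\varphi\|^2$ denotes the Borel measure $B\mapsto\|Q(B)\varphi\|^2$. -/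

import Mathlib

open MeasureTheory
open scoped ENNReal InnerProductSpace

noncomputable section

/-! ### Unbounded operators -/

section Operators

variable {E F G : Type*} [NormedAddCommGroup E] [InnerProductSpace ℂ E]
  [NormedAddCommGroup F] [InnerProductSpace ℂ F] [NormedAddCommGroup G] [InnerProductSpace ℂ G]

/-- The product `g f` of two unbounded operators, on its natural domain
`{x ∈ dom f | f x ∈ dom g}`. -/
def opComp (g : F →ₗ.[ℂ] G) (f : E →ₗ.[ℂ] F) : E →ₗ.[ℂ] G where
  domain :=
    { carrier := {x | ∃ h : x ∈ f.domain, f ⟨x, h⟩ ∈ g.domain}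
      add_mem' := by
        rintro x y ⟨hx, hgx⟩ ⟨hy, hgy⟩
        refine ⟨f.domain.add_mem hx hy, ?_⟩
        have h := f.map_add ⟨x, hx⟩ ⟨y, hy⟩
        rw [AddMemClass.mk_add_mk] at h
        rw [h]
        exact g.domain.add_mem hgx hgy
      zero_mem' := by
        refine ⟨f.domain.zero_mem, ?_⟩
        have h : f ⟨0, f.domain.zero_mem⟩ = 0 := f.map_zero
        rw [h]
        exact g.domain.zero_mem
      smul_mem' := by
        rintro c x ⟨hx, hgx⟩
        refine ⟨f.domain.smul_mem c hx, ?_⟩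
        have h := f.map_smul c ⟨x, hx⟩
        rw [SetLike.mk_smul_mk] at h
        rw [h]
        exact g.domain.smul_mem c hgx }
  toFun :=
    { toFun := fun x => g ⟨f ⟨x.1, x.2.choose⟩, x.2.choose_spec⟩
      map_add' := by
        intro x y
        rw [← g.map_add]
        congr 1
        apply Subtype.ext
        exact f.map_add ⟨x.1, x.2.choose⟩ ⟨y.1, y.2.choose⟩
      map_smul' := by
        intro c x
        rw [RingHom.id_apply, ← g.map_smul]
        congr 1
        apply Subtype.ext
        exact f.map_smul c ⟨x.1, x.2.choose⟩ }

/-- The operator `α I + A`, with domain `dom A`. -/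
def opShift (α : ℝ) (A : E →ₗ.[ℂ] E) : E →ₗ.[ℂ] E :=
  ((α : ℂ) • (LinearMap.id : E →ₗ[ℂ] E)) +ᵥ A

/-- The operator `(α I + A)⁻¹`, with domain the range of `α I + A`
(meaningful when `α I + A` is injective). -/
def opResolvent (α : ℝ) (A : E →ₗ.[ℂ] E) : E →ₗ.[ℂ] E :=
  (opShift α A).inverse

/-- `S` is a positive self-adjoint square root of `A`: `S = S*`, `S ≥ 0` and `S S = A`, with equality
of domains. -/
def IsPositiveSqrt [CompleteSpace E] (S A : E →ₗ.[ℂ] E) : Prop :=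
  IsSelfAdjoint S ∧ (∀ x : S.domain, 0 ≤ (⟪(x : E), S x⟫_ℂ).re) ∧ opComp S S = A

/-- The operator `T T*` in `F`. -/
def opTTStar [CompleteSpace E] (T : E →ₗ.[ℂ] F) : F →ₗ.[ℂ] F :=
  opComp T T.adjoint

/-- The operator `T* (α I + T T*)⁻¹` from `F` to `E`. -/
def featureOp [CompleteSpace E] (T : E →ₗ.[ℂ] F) (α : ℝ) : F →ₗ.[ℂ] E :=
  opComp T.adjoint (opResolvent α (opTTStar T))

/-- The operator `W u = (u, T u)` from `E` to `E × F`, with domain `dom T`. -/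
def graphOp (T : E →ₗ.[ℂ] F) : E →ₗ.[ℂ] E × F where
  domain := T.domain
  toFun := T.domain.subtype.prod T.toFun

/-- The inner product `α ⟨u₁, u₂⟩ + ⟨v₁, v₂⟩` of `(u₁, v₁)` and `(u₂, v₂)` in `E × F`. -/
def weightedInner (α : ℝ) (p q : E × F) : ℂ :=
  (α : ℂ) * ⟪p.1, q.1⟫_ℂ + ⟪p.2, q.2⟫_ℂ

/-- The squared norm on `E × F` given by the weighted inner product. -/
def weightedNormSq (α : ℝ) (p : E × F) : ℝ :=
  (weightedInner α p p).re

end Operators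

/-! ### Spectral measures -/

/-- A projection-valued measure on the Borel sets of `ℝ`, with values in the orthogonal projections
of the Hilbert space `E`. (The values on sets that are not Borel play no role.) -/
structure ProjectionMeasure (E : Type*) [NormedAddCommGroup E] [InnerProductSpace ℂ E]
    [CompleteSpace E] where
  proj : Set ℝ → E →L[ℂ] E
  isStarProjection : ∀ B, MeasurableSet B → IsStarProjection (proj B)
  proj_univ : proj Set.univ = 1
  proj_inter : ∀ B C, MeasurableSet B → MeasurableSet C → proj (B ∩ C) = proj B * proj C
  hasSum_iUnion : ∀ B : ℕ → Set ℝ, (∀ n, MeasurableSet (B n)) → Pairwise (Function.onFun Disjoint B) →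
    ∀ ξ, HasSum (fun n => proj (B n) ξ) (proj (⋃ n, B n) ξ)

namespace ProjectionMeasure

variable {E : Type*} [NormedAddCommGroup E] [InnerProductSpace ℂ E] [CompleteSpace E]
  (Q : ProjectionMeasure E)

theorem norm_sq_eq (ξ : E) {B : Set ℝ} (hB : MeasurableSet B) :
    ‖Q.proj B ξ‖ ^ 2 = (⟪ξ, Q.proj B ξ⟫_ℂ).re := by
  have h := Q.isStarProjection B hB
  have h1 : ⟪Q.proj B ξ, Q.proj B ξ⟫_ℂ = ⟪ξ, Q.proj B ξ⟫_ℂ := by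
    rw [← ContinuousLinearMap.adjoint_inner_right, ← ContinuousLinearMap.star_eq_adjoint,
      h.isSelfAdjoint.star_eq, ← mul_apply_eq_comp, h.isIdempotentElem.eq]
  rw [← h1, inner_self_eq_norm_sq_to_K]
  norm_cast

theorem proj_empty : Q.proj ∅ = 0 := by
  ext ξ
  have h := Q.hasSum_iUnion (fun _ => ∅) (fun _ => MeasurableSet.empty)
    (fun _ _ _ => disjoint_bot_left) ξ
  simpa using tendsto_nhds_unique tendsto_const_nhds h.summable.tendsto_atTop_zero

theorem hasSum_norm_sq (ξ : E) (B : ℕ → Set ℝ) (hB : ∀ n, MeasurableSet (B n))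
    (hd : Pairwise (Function.onFun Disjoint B)) :
    HasSum (fun n => ‖Q.proj (B n) ξ‖ ^ 2) (‖Q.proj (⋃ n, B n) ξ‖ ^ 2) := by
  have h := (Q.hasSum_iUnion B hB hd ξ).mapL (Complex.reCLM ∘L (innerSL ℂ ξ).restrictScalars ℝ)
  simp only [Q.norm_sq_eq ξ (hB _), Q.norm_sq_eq ξ (MeasurableSet.iUnion hB)]
  exact h

/-- The scalar Borel measure `B ↦ ‖Q(B) ξ‖²` on `ℝ`, written `‖Q(dx) ξ‖²` in integrals. -/
def scalarMeasure (ξ : E) : Measure ℝ :=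
  Measure.ofMeasurable (fun B _ => ENNReal.ofReal (‖Q.proj B ξ‖ ^ 2))
    (by simp [Q.proj_empty])
    (by
      intro B hB hd
      have h := Q.hasSum_norm_sq ξ B hB hd
      rw [← h.tsum_eq, ENNReal.ofReal_tsum_of_nonneg (fun n => by positivity) h.summable])

theorem scalarMeasure_apply (ξ : E) {B : Set ℝ} (hB : MeasurableSet B) :
    Q.scalarMeasure ξ B = ENNReal.ofReal (‖Q.proj B ξ‖ ^ 2) :=
  Measure.ofMeasurable_apply B hB

/-- `A = ∫ x Q(dx)`, i.e. `Q` is the spectral measure of `A`: the domain of `A` consists of the `ξ`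
with `∫ x² ‖Q(dx) ξ‖² < ∞`, and `⟨ξ, A ξ⟩ = ∫ x ‖Q(dx) ξ‖²` on it. By polarization the last
condition determines `⟨η, A ξ⟩` for all `η`, `ξ` in the (dense) domain, hence `A`. -/
def IsSpectralMeasureOf (A : E →ₗ.[ℂ] E) : Prop :=
  (∀ ξ, ξ ∈ A.domain ↔ Integrable (fun x : ℝ => x ^ 2) (Q.scalarMeasure ξ)) ∧
    ∀ ξ : A.domain, ⟪(ξ : E), A ξ⟫_ℂ = ((∫ x, x ∂Q.scalarMeasure (ξ : E) : ℝ) : ℂ)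

end ProjectionMeasure

/-! ### The operator attached to a kernel and a measure -/

section Kernel

variable {X : Type*} {H : Type*} [NormedAddCommGroup H] [InnerProductSpace ℂ H]
  [CompleteSpace H] [RKHS ℂ H X ℂ]

/-- `H` is the reproducing kernel Hilbert space `H_K` of the scalar kernel `K`: the kernel function
at `y` is `K(·, y)`, and `⟨K(·, y), f⟩ = f y` for all `f ∈ H`. -/
def HasKernel (H : Type*) [NormedAddCommGroup H] [InnerProductSpace ℂ H]
    [CompleteSpace H] [RKHS ℂ H X ℂ] (K : X → X → ℂ) : Prop :=
  ∀ x y, RKHS.kernel H x y 1 = K x y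

/-- The linear span of the functions `K(·, y)` in `H_K`. -/
def kernelSpan (H : Type*) [NormedAddCommGroup H] [InnerProductSpace ℂ H]
    [CompleteSpace H] [RKHS ℂ H X ℂ] : Submodule ℂ H :=
  Submodule.span ℂ (Set.range fun y : X => RKHS.kerFun H y (1 : ℂ))

theorem HasKernel.coe_kerFun {K : X → X → ℂ} (hK : HasKernel H K) (y : X) :
    ⇑(RKHS.kerFun H y (1 : ℂ)) = fun x => K x y := by
  funext x
  rw [RKHS.kerFun_apply, hK x y]

theorem HasKernel.memLp_of_mem_span [MeasurableSpace X] {K : X → X → ℂ} (hK : HasKernel H K) {μ : Measure X}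
    (hμ : ∀ y, MemLp (fun x => K x y) 2 μ) {f : H} (hf : f ∈ kernelSpan H) :
    MemLp (⇑f) 2 μ := by
  induction hf using Submodule.span_induction with
  | mem f hf =>
    obtain ⟨y, rfl⟩ := hf
    simpa only [hK.coe_kerFun] using hμ y
  | zero => rw [RKHS.coe_zero]; exact MemLp.zero
  | add f g _ _ hf hg => rw [RKHS.coe_add]; exact hf.add hg
  | smul c f _ hf => rw [RKHS.coe_smul]; exact hf.const_smul c

variable [MeasurableSpace X]

/-- The map `H_K ∋ K(·, y) ↦ K(·, y) ∈ L²(μ)`, extended by linearity to the linear span of the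
functions `K(·, y)`. It sends an element of the span, which is a function on `X`, to its class in
`L²(μ)`; in particular it is well defined as soon as every `K(·, y)` is in `L²(μ)`. -/
def kernelOpCore {K : X → X → ℂ} (hK : HasKernel H K) {μ : Measure X}
    (hμ : ∀ y, MemLp (fun x => K x y) 2 μ) : H →ₗ.[ℂ] Lp ℂ 2 μ where
  domain := kernelSpan H
  toFun :=
    { toFun := fun f => (hK.memLp_of_mem_span hμ f.2).toLp (f : H)
      map_add' := by
        intro f g
        rw [← MemLp.toLp_add]
        exact MemLp.toLp_congr _ _ (by simp)
      map_smul' := by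
        intro c f
        rw [RingHom.id_apply, ← MemLp.toLp_const_smul]
        exact MemLp.toLp_congr _ _ (by simp) }

/-- The pair `(K, μ)` is admissible: `K(·, y) ↦ K(·, y)`, extended by linearity, is a well defined
and closable operator from `H_K` to `L²(μ)`. -/
structure Admissible {K : X → X → ℂ} (hK : HasKernel H K) (μ : Measure X) : Prop where
  memLp : ∀ y, MemLp (fun x => K x y) 2 μ
  closable : (kernelOpCore hK memLp).IsClosable

/-- The closed operator `T = T_{μ,K}` from `H_K` to `L²(μ)` of an admissible pair: the closure of
`K(·, y) ↦ K(·, y)`. -/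
def Admissible.op {K : X → X → ℂ} {hK : HasKernel H K} {μ : Measure X} (h : Admissible hK μ) :
    H →ₗ.[ℂ] Lp ℂ 2 μ :=
  (kernelOpCore hK h.memLp).closure

end Kernel

end

/-! ### Unbounded operators handled through their graphs -/

section OperatorGraphs

variable {E F G : Type*} [NormedAddCommGroup E] [InnerProductSpace ℂ E]
  [NormedAddCommGroup F] [InnerProductSpace ℂ F] [NormedAddCommGroup G] [InnerProductSpace ℂ G]

/-! Write `A = T T*`, `ψ = (α + A)⁻¹ φ` and `f = T* ψ`. Then `φ = αψ + Aψ`, `T f = Aψ` and `‖f‖² =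
⟨ψ, Aψ⟩`, so every claim about `f` becomes one about `ψ`. The key identity is `‖Q(dx)φ‖² = (α + x)²
‖Q(dx)ψ‖²` (`scalarMeasure_shift`): it turns the integral of `x/(α+x)²` into `∫ x ‖Q(dx)ψ‖² = ⟨ψ,
Aψ⟩`, and that of `x/(α+x)` into `∫ (αx + x²) ‖Q(dx)ψ‖² = α‖f‖² + ‖Tf‖²`. The final bound is the
expansion of `‖αψ + Aψ‖²`.

Self-adjointness of `A` is von Neumann's theorem: `T` is densely defined by the reproducing
property, and `α + A` is onto by an orthogonal projection to the graph of `T`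
(`exists_mem_graph_opTTStar`). This makes `R = (1 + A)⁻¹` a bounded operator with `0 ≤ R ≤ 1`. The
square root and a spectral measure of `A` come from the continuous functional calculus of `R`:
Riesz–Markov gives scalar measures, projections are limits of continuous functions of `R`, and `x ↦
x⁻¹ - 1` carries the result from `R` to `A`.

An arbitrary `Q` is known only through the domain of `A` and the quadratic form. Polarization shows
that it commutes with `A` (`proj_graph`); positivity puts it on `[0, ∞)`, and a truncation argument
gives `‖Aξ‖² = ∫ x² ‖Q(dx)ξ‖²` (`norm_sq_eq_integral`), from which the key identity follows. -/

theorem LinearPMap.mem_domain_of_graph {f : E →ₗ.[ℂ] F} {x : E} {y : F} (h : (x, y) ∈ f.graph) :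
    ∃ hx : x ∈ f.domain, f ⟨x, hx⟩ = y := by
  obtain ⟨⟨z, hz⟩, rfl, h2⟩ := (LinearPMap.mem_graph_iff f).1 h
  exact ⟨hz, h2⟩

theorem mem_graph_opComp {g : F →ₗ.[ℂ] G} {f : E →ₗ.[ℂ] F} {x : E} {z : G} :
    (x, z) ∈ (opComp g f).graph ↔ ∃ y, (x, y) ∈ f.graph ∧ (y, z) ∈ g.graph := by
  constructor
  · intro h
    obtain ⟨hx, rfl⟩ := LinearPMap.mem_domain_of_graph h
    exact ⟨_, f.mem_graph ⟨x, hx.choose⟩, g.mem_graph ⟨_, hx.choose_spec⟩⟩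
  · rintro ⟨y, h1, h2⟩
    obtain ⟨hx, rfl⟩ := LinearPMap.mem_domain_of_graph h1
    obtain ⟨hy, rfl⟩ := LinearPMap.mem_domain_of_graph h2
    exact (opComp g f).mem_graph ⟨x, ⟨hx, hy⟩⟩

theorem mem_graph_opShift {α : ℝ} {A : E →ₗ.[ℂ] E} {x z : E} :
    (x, z) ∈ (opShift α A).graph ↔ (x, z - (α : ℂ) • x) ∈ A.graph := by
  constructor
  · intro h
    obtain ⟨hx, rfl⟩ := LinearPMap.mem_domain_of_graph h
    have : opShift α A ⟨x, hx⟩ - (α : ℂ) • x = A ⟨x, hx⟩ := by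
      rw [sub_eq_iff_eq_add, add_comm]; rfl
    rw [this]
    exact A.mem_graph ⟨x, hx⟩
  · intro h
    obtain ⟨hx, h2⟩ := LinearPMap.mem_domain_of_graph h
    have : z = opShift α A ⟨x, hx⟩ := by
      rw [eq_comm, sub_eq_iff_eq_add, add_comm] at h2; exact h2
    rw [this]
    exact (opShift α A).mem_graph ⟨x, hx⟩

theorem mem_graph_opResolvent {α : ℝ} {A : E →ₗ.[ℂ] E}
    (hA : Function.Injective (opShift α A)) {x z : E} :
    (z, x) ∈ (opResolvent α A).graph ↔ (x, z - (α : ℂ) • x) ∈ A.graph := by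
  have hk : (opShift α A).toFun.ker = ⊥ := LinearMap.ker_eq_bot.2 hA
  rw [← mem_graph_opShift, opResolvent, LinearPMap.inverse_graph hk]
  simp

theorem mem_graph_adjoint [CompleteSpace E] {T : E →ₗ.[ℂ] F} (hT : Dense (T.domain : Set E))
    {y : F} {w : E} : (y, w) ∈ T.adjoint.graph ↔ ∀ x z, (x, z) ∈ T.graph → ⟪z, y⟫_ℂ = ⟪x, w⟫_ℂ := by
  rw [LinearPMap.adjoint_graph_eq_graph_adjoint hT, Submodule.mem_adjoint_iff]
  simp only [sub_eq_zero]

/-- A symmetric operator with surjective `α + A` that is bounded below is self-adjoint. -/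
theorem isSelfAdjoint_of_surjective_shift [CompleteSpace E] {A : E →ₗ.[ℂ] E} {α : ℝ} (hα : 0 < α)
    (hsymm : ∀ x y x' y', (x, y) ∈ A.graph → (x', y') ∈ A.graph → ⟪y, x'⟫_ℂ = ⟪x, y'⟫_ℂ)
    (hpos : ∀ x y, (x, y) ∈ A.graph → 0 ≤ (⟪x, y⟫_ℂ).re)
    (hsurj : ∀ φ, ∃ x, (x, φ - (α : ℂ) • x) ∈ A.graph) : IsSelfAdjoint A := by
  have hdense : Dense (A.domain : Set E) := by
    rw [Submodule.dense_iff_topologicalClosure_eq_top, Submodule.topologicalClosure_eq_top_iff,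
      Submodule.eq_bot_iff]
    intro φ hφ
    -- If `φ = αx + Ax` is orthogonal to the domain, then `⟨x, Ax⟩ = -α‖x‖²`, and positivity forces
    -- `x = 0`, hence `φ = 0`.
    obtain ⟨x, hx⟩ := hsurj φ
    have h1 : ⟪x, φ⟫_ℂ = 0 := hφ x (LinearPMap.mem_domain_of_mem_graph hx)
    have h2 := hpos _ _ hx
    rw [inner_sub_right, h1, inner_smul_right, inner_self_eq_norm_sq_to_K] at h2
    have h3 : 0 ≤ -(α * ‖x‖ ^ 2) := by
      have : (0 - (α : ℂ) * ((‖x‖ : ℝ) : ℂ) ^ 2) = ((-(α * ‖x‖ ^ 2) : ℝ) : ℂ) := by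
        push_cast; ring
      erw [this] at h2
      exact h2
    have h4 : ‖x‖ ^ 2 ≤ 0 := by nlinarith [sq_nonneg ‖x‖]
    have h5 : x = 0 := by simpa using le_antisymm h4 (sq_nonneg _)
    subst h5
    simpa using A.graph_fst_eq_zero_snd hx rfl
  rw [LinearPMap.isSelfAdjoint_def]
  apply LinearPMap.eq_of_eq_graph
  ext ⟨y, w⟩
  rw [mem_graph_adjoint hdense]
  constructor
  · intro h
    obtain ⟨x, hx⟩ := hsurj (w + (α : ℂ) • y)
    have key : y - x = 0 := by
      -- The adjoint relation and symmetry make `y - x` orthogonal to `(α + A)z`, which is `y - x`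
      -- itself for this `z`.
      obtain ⟨z, hz⟩ := hsurj (y - x)
      have e1 := h _ _ hz
      have e2 := hsymm _ _ _ _ hz hx
      simp only [inner_sub_left, inner_sub_right, inner_smul_left, inner_smul_right, inner_add_right,
        Complex.conj_ofReal] at e1 e2
      rw [← inner_self_eq_zero (𝕜 := ℂ), inner_sub_left, inner_sub_right, inner_sub_right]
      linear_combination e1 - e2
    obtain rfl : y = x := sub_eq_zero.1 key
    simpa using hx
  · intro h x z hx
    exact hsymm _ _ _ _ hx h

end OperatorGraphs

/-! ### The operator `T T*` for closed, densely defined `T` -/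

section ClosedOperators

variable {E F : Type*} [NormedAddCommGroup E] [InnerProductSpace ℂ E] [CompleteSpace E]
  [NormedAddCommGroup F] [InnerProductSpace ℂ F] {T : E →ₗ.[ℂ] F}

theorem mem_graph_opTTStar {x z : F} :
    (x, z) ∈ (opTTStar T).graph ↔ ∃ y, (x, y) ∈ T.adjoint.graph ∧ (y, z) ∈ T.graph :=
  mem_graph_opComp

/-- Moving one `T` across the inner product leaves `⟨T*x, T*x'⟩` on either side; symmetry and
positivity of `T T*` both follow. -/
theorem inner_opTTStar (hT : Dense (T.domain : Set E)) {x z f x' z' f' : _}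
    (h1 : (x, f) ∈ T.adjoint.graph) (h2 : (f, z) ∈ T.graph)
    (h1' : (x', f') ∈ T.adjoint.graph) (h2' : (f', z') ∈ T.graph) :
    ⟪x, z'⟫_ℂ = ⟪f, f'⟫_ℂ ∧ ⟪z, x'⟫_ℂ = ⟪f, f'⟫_ℂ := by
  rw [mem_graph_adjoint hT] at h1 h1'
  refine ⟨?_, h1' _ _ h2⟩
  rw [← inner_conj_symm, h1 _ _ h2', inner_conj_symm]

theorem opTTStar_symm (hT : Dense (T.domain : Set E)) (x y x' y' : F)
    (h : (x, y) ∈ (opTTStar T).graph) (h' : (x', y') ∈ (opTTStar T).graph) :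
    ⟪y, x'⟫_ℂ = ⟪x, y'⟫_ℂ := by
  obtain ⟨f, h1, h2⟩ := mem_graph_opTTStar.1 h
  obtain ⟨f', h1', h2'⟩ := mem_graph_opTTStar.1 h'
  obtain ⟨e1, e2⟩ := inner_opTTStar hT h1 h2 h1' h2'
  rw [e1, e2]

theorem opTTStar_pos (hT : Dense (T.domain : Set E)) (x y : F)
    (h : (x, y) ∈ (opTTStar T).graph) : 0 ≤ (⟪x, y⟫_ℂ).re := by
  obtain ⟨f, h1, h2⟩ := mem_graph_opTTStar.1 h
  rw [(inner_opTTStar hT h1 h2 h1 h2).1]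
  exact inner_self_nonneg (𝕜 := ℂ)

/-- For a closed densely defined `T`, the operator `α + T T*` is onto. The solution comes from the
orthogonal projection of `(0, φ)` to the closed subspace of all `(√α h, T h)`. -/
theorem exists_mem_graph_opTTStar [CompleteSpace F] (hT : Dense (T.domain : Set E)) (hc : T.IsClosed)
    {α : ℝ} (hα : 0 < α) (φ : F) : ∃ ψ, (ψ, φ - (α : ℂ) • ψ) ∈ (opTTStar T).graph := by
  set s : ℝ := √α
  have hs : 0 < s := Real.sqrt_pos.2 hα
  have hss : s * s = α := Real.mul_self_sqrt hα.le
  have hsC : (s : ℂ) ≠ 0 := by exact_mod_cast hs.ne'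
  let L : WithLp 2 (E × F) →L[ℂ] E × F :=
    ((s⁻¹ : ℂ) • ContinuousLinearMap.fst ℂ E F).prod (ContinuousLinearMap.snd ℂ E F) ∘L
      (WithLp.prodContinuousLinearEquiv 2 ℂ E F).toContinuousLinearMap
  have hL : ∀ p, L p = ((s⁻¹ : ℂ) • p.fst, p.snd) := fun p => rfl
  let V : Submodule ℂ (WithLp 2 (E × F)) := T.graph.comap (L : WithLp 2 (E × F) →ₗ[ℂ] E × F)
  have hV : ∀ p, p ∈ V ↔ ((s⁻¹ : ℂ) • p.fst, p.snd) ∈ T.graph := fun p => Iff.rfl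
  have hVc : IsClosed (V : Set (WithLp 2 (E × F))) := hc.preimage L.continuous
  have : CompleteSpace V := hVc.completeSpace_coe
  let q : WithLp 2 (E × F) := WithLp.toLp 2 (0, φ)
  let p := V.starProjection q
  have hp : p ∈ V := V.starProjection_apply_mem q
  have horth : ∀ r ∈ V, ⟪r, q - p⟫_ℂ = 0 := fun r hr =>
    (V.sub_starProjection_mem_orthogonal q) r hr
  have hf := (hV p).1 hp
  set f : E := (s⁻¹ : ℂ) • p.fst with hfdef
  have hpf : p.fst = (s : ℂ) • f := by rw [hfdef, smul_smul, mul_inv_cancel₀ hsC, one_smul]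
  -- The projection is `(√α f, Tf)`. Orthogonality of the residual to every `(√α x, Tx)` reads `⟨Tx,
  -- φ - Tf⟩ = α⟨x, f⟩`, that is `T*(φ - Tf) = αf`; so `ψ = α⁻¹(φ - Tf)` solves the equation.
  have hadj : (φ - p.snd, (α : ℂ) • f) ∈ T.adjoint.graph := by
    rw [mem_graph_adjoint hT]
    intro x z hxz
    have h := horth (WithLp.toLp 2 ((s : ℂ) • x, z)) (by
      rw [hV]
      change ((s⁻¹ : ℂ) • (s : ℂ) • x, z) ∈ T.graph
      rwa [smul_smul, inv_mul_cancel₀ hsC, one_smul])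
    rw [WithLp.prod_inner_apply] at h
    simp only [q, WithLp.ofLp_sub, Prod.fst_sub, Prod.snd_sub, zero_sub] at h
    change ⟪(s : ℂ) • x, -p.fst⟫_ℂ + ⟪z, φ - p.snd⟫_ℂ = 0 at h
    rw [hpf, inner_neg_right, inner_smul_left, inner_smul_right, Complex.conj_ofReal] at h
    rw [inner_smul_right, ← hss]
    push_cast
    linear_combination h
  have hαC : (α : ℂ) ≠ 0 := by exact_mod_cast hα.ne'
  refine ⟨(α : ℂ)⁻¹ • (φ - p.snd), mem_graph_opTTStar.2 ⟨f, ?_, ?_⟩⟩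
  · have := T.adjoint.graph.smul_mem (α : ℂ)⁻¹ hadj
    rwa [Prod.smul_mk, smul_smul, inv_mul_cancel₀ hαC, one_smul] at this
  · rw [smul_smul, mul_inv_cancel₀ hαC, one_smul, sub_sub_cancel]
    exact hf

theorem isSelfAdjoint_opTTStar [CompleteSpace F] (hT : Dense (T.domain : Set E)) (hc : T.IsClosed) :
    IsSelfAdjoint (opTTStar T) :=
  isSelfAdjoint_of_surjective_shift one_pos (opTTStar_symm hT) (opTTStar_pos hT)
    (exists_mem_graph_opTTStar hT hc one_pos)

end ClosedOperators

/-! ### Bijectivity of `α + A` and the bounded resolvent -/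

section Shift

variable {F : Type*} [NormedAddCommGroup F] [InnerProductSpace ℂ F] {A : F →ₗ.[ℂ] F}

/-- In the expansion of `‖αx + y‖²` the cross term is nonnegative. This yields both injectivity of
`α + A` and boundedness of its inverse. -/
theorem shift_norm_le (hpos : ∀ x y, (x, y) ∈ A.graph → 0 ≤ (⟪x, y⟫_ℂ).re) {α : ℝ} (hα : 0 ≤ α)
    {x y : F} (h : (x, y) ∈ A.graph) : α * ‖x‖ ≤ ‖(α : ℂ) • x + y‖ := by
  have h1 := hpos _ _ h
  have h2 : ‖(α : ℂ) • x + y‖ ^ 2 = α ^ 2 * ‖x‖ ^ 2 + 2 * (α * (⟪x, y⟫_ℂ).re) + ‖y‖ ^ 2 := by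
    rw [@norm_add_sq ℂ, norm_smul, inner_smul_left, Complex.conj_ofReal, mul_pow,
      Complex.norm_real, Real.norm_eq_abs, sq_abs]
    simp
  have h3 : 0 ≤ α * (⟪x, y⟫_ℂ).re := mul_nonneg hα h1
  refine le_of_sq_le_sq ?_ (norm_nonneg _)
  rw [h2, mul_pow]
  nlinarith [sq_nonneg ‖y‖]

theorem opShift_injective (hpos : ∀ x y, (x, y) ∈ A.graph → 0 ≤ (⟪x, y⟫_ℂ).re) {α : ℝ}
    (hα : 0 < α) : Function.Injective (opShift α A) := by
  refine (injective_iff_map_eq_zero (opShift α A).toFun).2 ?_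
  rintro ⟨x, hx⟩ h
  have h1 : (x, (0 : F)) ∈ (opShift α A).graph := by
    have := (opShift α A).mem_graph ⟨x, hx⟩
    rwa [show opShift α A ⟨x, hx⟩ = 0 from h] at this
  have h2 := shift_norm_le hpos hα.le (mem_graph_opShift.1 h1)
  have h3 : ‖x‖ ≤ 0 := by
    simp only [zero_sub, add_neg_cancel, norm_zero] at h2
    nlinarith [norm_nonneg x]
  exact Subtype.ext (norm_le_zero_iff.1 h3)

theorem opShift_bijective (hpos : ∀ x y, (x, y) ∈ A.graph → 0 ≤ (⟪x, y⟫_ℂ).re) {α : ℝ}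
    (hα : 0 < α) (hsurj : ∀ φ, ∃ x, (x, φ - (α : ℂ) • x) ∈ A.graph) :
    Function.Bijective (opShift α A) := by
  refine ⟨opShift_injective hpos hα, fun φ => ?_⟩
  obtain ⟨x, hx⟩ := hsurj φ
  obtain ⟨hd, he⟩ := LinearPMap.mem_domain_of_graph (mem_graph_opShift.2 hx)
  exact ⟨⟨x, hd⟩, he⟩

/-- The bounded inverse of `1 + A` for a positive symmetric operator `A` with `1 + A` onto. -/
theorem exists_resolvent [CompleteSpace F]
    (hsymm : ∀ x y x' y', (x, y) ∈ A.graph → (x', y') ∈ A.graph → ⟪y, x'⟫_ℂ = ⟪x, y'⟫_ℂ)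
    (hpos : ∀ x y, (x, y) ∈ A.graph → 0 ≤ (⟪x, y⟫_ℂ).re)
    (hsurj : ∀ φ, ∃ x, (x, φ - ((1 : ℝ) : ℂ) • x) ∈ A.graph) :
    ∃ R : F →L[ℂ] F, 0 ≤ R ∧ R ≤ 1 ∧ ∀ x y, (x, y) ∈ A.graph ↔ R (x + y) = x := by
  choose r hr using hsurj
  simp only [Complex.ofReal_one, one_smul] at hr
  -- Uniqueness of the solution makes the chosen function `r` linear.
  have huniq : ∀ x y, (x, y) ∈ A.graph → r (x + y) = x := by
    intro x y h
    have h1 : (r (x + y) - x, x + y - r (x + y) - y) ∈ A.graph := A.graph.sub_mem (hr (x + y)) h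
    have h2 := shift_norm_le hpos zero_le_one h1
    have h3 : r (x + y) - x + (x + y - r (x + y) - y) = 0 := by abel
    rw [Complex.ofReal_one, one_smul, h3, norm_zero, one_mul] at h2
    exact sub_eq_zero.1 (norm_le_zero_iff.1 h2)
  have hadd : ∀ φ ψ, r (φ + ψ) = r φ + r ψ := by
    intro φ ψ
    have : r (r φ + r ψ + (φ - r φ + (ψ - r ψ))) = r φ + r ψ :=
      huniq _ _ (A.graph.add_mem (hr φ) (hr ψ))
    rw [← this]; congr 1; abel
  have hsmul : ∀ (c : ℂ) φ, r (c • φ) = c • r φ := by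
    intro c φ
    have : r (c • r φ + c • (φ - r φ)) = c • r φ := huniq _ _ (A.graph.smul_mem c (hr φ))
    rw [← this, ← smul_add, add_sub_cancel]
  have hnorm : ∀ φ, ‖r φ‖ ≤ 1 * ‖φ‖ := by
    intro φ
    have := shift_norm_le hpos zero_le_one (hr φ)
    simpa using this
  let R : F →L[ℂ] F := LinearMap.mkContinuous ⟨⟨r, hadd⟩, hsmul⟩ 1 hnorm
  have hR : ∀ φ, R φ = r φ := fun φ => rfl
  have hsa : ∀ x y, ⟪R x, y⟫_ℂ = ⟪x, R y⟫_ℂ := by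
    intro x y
    have := hsymm _ _ _ _ (hr x) (hr y)
    simp only [inner_sub_left, inner_sub_right] at this
    rw [hR, hR]
    linear_combination -this
  have hsa' : ∀ x y, ⟪(1 - R) x, y⟫_ℂ = ⟪x, (1 - R) y⟫_ℂ := by
    intro x y
    simp [hsa]
  refine ⟨R, ?_, ?_, ?_⟩
  · rw [ContinuousLinearMap.nonneg_iff_isPositive, ContinuousLinearMap.isPositive_def]
    refine ⟨hsa, fun x => ?_⟩
    -- `⟨Rx, x⟩ = ‖Rx‖² + ⟨Rx, A Rx⟩`, since `A Rx = x - Rx`.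
    have h1 := hpos _ _ (hr x)
    rw [inner_sub_right, inner_self_eq_norm_sq_to_K] at h1
    have h2 : 0 ≤ (⟪r x, x⟫_ℂ).re - ‖r x‖ ^ 2 := by
      refine h1.trans_eq ?_
      rw [Complex.sub_re]
      norm_cast
    rw [ContinuousLinearMap.reApplyInnerSelf]
    change 0 ≤ (⟪r x, x⟫_ℂ).re
    nlinarith [sq_nonneg ‖r x‖]
  · rw [← sub_nonneg, ContinuousLinearMap.nonneg_iff_isPositive, ContinuousLinearMap.isPositive_def]
    refine ⟨hsa', fun x => ?_⟩
    have h1 := hpos _ _ (hr x)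
    have h2 : (⟪x - r x, x⟫_ℂ) = ⟪x - r x, x - r x⟫_ℂ + ⟪x - r x, r x⟫_ℂ := by
      rw [← inner_add_right, sub_add_cancel]
    rw [ContinuousLinearMap.reApplyInnerSelf]
    change 0 ≤ (⟪x - r x, x⟫_ℂ).re
    rw [h2, Complex.add_re, ← inner_conj_symm, Complex.conj_re]
    exact add_nonneg (inner_self_nonneg (𝕜 := ℂ)) (by
      rw [← inner_conj_symm, Complex.conj_re]; exact h1)
  · intro x y
    refine ⟨huniq x y, fun h => ?_⟩
    have := hr (x + y)
    rw [← hR, h] at this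
    simpa using this

end Shift

/-! ### Density and closedness for the kernel operator -/

section Kernel

variable {X : Type*} {H : Type*} [NormedAddCommGroup H] [InnerProductSpace ℂ H]
  [CompleteSpace H] [RKHS ℂ H X ℂ]

/-- By the reproducing property, a function orthogonal to all `K(·, y)` vanishes at every point. -/
theorem dense_kernelSpan : Dense (kernelSpan H : Set H) := by
  rw [Submodule.dense_iff_topologicalClosure_eq_top, Submodule.topologicalClosure_eq_top_iff,
    Submodule.eq_bot_iff]
  intro f hf
  refine RKHS.ext fun x => ?_
  have := hf _ (Submodule.subset_span ⟨x, rfl⟩)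
  rw [RKHS.kerFun_inner] at this
  simpa using this

variable [MeasurableSpace X]

theorem Admissible.dense_domain {K : X → X → ℂ} {hK : HasKernel H K} {μ : Measure X}
    (h : Admissible hK μ) : Dense (h.op.domain : Set H) :=
  (dense_kernelSpan (H := H)).mono
    ((LinearPMap.le_closure (kernelOpCore hK h.memLp)).1)

theorem Admissible.isClosed {K : X → X → ℂ} {hK : HasKernel H K} {μ : Measure X}
    (h : Admissible hK μ) : h.op.IsClosed :=
  h.closable.closure_isClosed

end Kernel

/-! ### From a continuous functional calculus to a projection-valued measure -/

section FunctionalCalculus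

open Filter Topology

variable {E : Type*} [NormedAddCommGroup E] [InnerProductSpace ℂ E] [CompleteSpace E]
  {X : Type*} [MetricSpace X] [CompactSpace X] [MeasurableSpace X] [BorelSpace X]
  (Φ : C(X, ℝ) →⋆ₐ[ℝ] (E →L[ℂ] E))

theorem ContinuousMap.integrable_of_compactSpace (f : C(X, ℝ)) (μ : Measure X) [IsFiniteMeasure μ] :
    Integrable f μ :=
  f.continuous.integrable_of_hasCompactSupport (HasCompactSupport.of_compactSpace f)

theorem ContinuousMap.integrable_sq (f : C(X, ℝ)) (μ : Measure X) [IsFiniteMeasure μ] :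
    Integrable (fun x => f x ^ 2) μ :=
  (f ^ 2).integrable_of_compactSpace μ

omit [CompactSpace X] [MeasurableSpace X] [BorelSpace X] in
theorem inner_starHom (f : C(X, ℝ)) (ξ η : E) :
    ⟪Φ f ξ, η⟫_ℂ = ⟪ξ, Φ f η⟫_ℂ := by
  rw [← ContinuousLinearMap.adjoint_inner_right, ← ContinuousLinearMap.star_eq_adjoint, ← map_star,
    star_trivial]

omit [CompactSpace X] [MeasurableSpace X] [BorelSpace X] in
theorem norm_sq_starHom (f : C(X, ℝ)) (ξ : E) : ‖Φ f ξ‖ ^ 2 = (⟪ξ, Φ (f * f) ξ⟫_ℂ).re := by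
  rw [map_mul, mul_apply_eq_comp, ← inner_starHom, inner_self_eq_norm_sq_to_K]
  norm_cast

/-- Riesz–Markov applied to `f ↦ Re ⟨ξ, Φ(f) ξ⟩`, which is positive because `f = √f · √f` gives the
value `‖Φ(√f) ξ‖²`. -/
theorem exists_diagMeasure (ξ : E) : ∃ μ : Measure X, IsFiniteMeasure μ ∧
    ∀ f : C(X, ℝ), ∫ x, f x ∂μ = (⟪ξ, Φ f ξ⟫_ℂ).re := by
  let e : CompactlySupportedContinuousMap X ℝ →ₗ[ℝ] C(X, ℝ) :=
    { toFun := fun f => f.toContinuousMap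
      map_add' := fun _ _ => rfl
      map_smul' := fun _ _ => rfl }
  let Λ₀ : CompactlySupportedContinuousMap X ℝ →ₗ[ℝ] ℝ :=
    { toFun := fun f => (⟪ξ, Φ (e f) ξ⟫_ℂ).re
      map_add' := fun f g => by simp
      map_smul' := fun c f => by
        rw [map_smul, map_smul, _root_.smul_apply, ← Complex.coe_smul,
          inner_smul_right]
        simp }
  let Λ : CompactlySupportedContinuousMap X ℝ →ₚ[ℝ] ℝ := PositiveLinearMap.mk₀ Λ₀ (by
    intro f hf
    let g : C(X, ℝ) := ⟨fun x => √(f x), by fun_prop⟩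
    have hg : e f = g * g := by
      ext x
      exact (Real.mul_self_sqrt (hf x)).symm
    change 0 ≤ (⟪ξ, Φ (e f) ξ⟫_ℂ).re
    rw [hg, ← norm_sq_starHom]
    positivity)
  have : (RealRMK.rieszMeasure Λ).Regular := by
    unfold RealRMK.rieszMeasure; infer_instance
  refine ⟨RealRMK.rieszMeasure Λ, inferInstance, fun f => ?_⟩
  exact RealRMK.integral_rieszMeasure Λ (CompactlySupportedContinuousMap.continuousMapEquiv f)

/-- The finite measure `μ_ξ` with `∫ f dμ_ξ = ⟨ξ, Φ(f) ξ⟩` for continuous `f`. -/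
noncomputable def diagMeasure (ξ : E) : Measure X := (exists_diagMeasure Φ ξ).choose

instance (ξ : E) : IsFiniteMeasure (diagMeasure Φ ξ) := (exists_diagMeasure Φ ξ).choose_spec.1

theorem integral_diagMeasure (ξ : E) (f : C(X, ℝ)) :
    ∫ x, f x ∂diagMeasure Φ ξ = (⟪ξ, Φ f ξ⟫_ℂ).re := (exists_diagMeasure Φ ξ).choose_spec.2 f

theorem norm_sq_starHom_eq_integral (f : C(X, ℝ)) (ξ : E) :
    ‖Φ f ξ‖ ^ 2 = ∫ x, f x ^ 2 ∂diagMeasure Φ ξ := by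
  rw [norm_sq_starHom, ← integral_diagMeasure]
  simp [sq]

/-- Both finite measures integrate a continuous `f` to `Re ⟨ξ, Φ(h f h) ξ⟩`. -/
theorem diagMeasure_starHom (h : C(X, ℝ)) (ξ : E) : diagMeasure Φ (Φ h ξ) =
    (diagMeasure Φ ξ).withDensity fun x => ENNReal.ofReal (h x ^ 2) := by
  have hm : Measurable fun x => (h x ^ 2).toNNReal := by
    have := h.continuous.measurable; fun_prop
  have hi : Integrable (fun x => h x ^ 2) (diagMeasure Φ ξ) := 
    h.integrable_sq _
  have : IsFiniteMeasure ((diagMeasure Φ ξ).withDensity fun x => ENNReal.ofReal (h x ^ 2)) :=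
    isFiniteMeasure_withDensity_ofReal hi.2
  refine ext_of_forall_integral_eq_of_IsFiniteMeasure fun f => ?_
  have e1 := integral_diagMeasure Φ (Φ h ξ) f.toContinuousMap
  have e2 := integral_diagMeasure Φ ξ (h * f.toContinuousMap * h)
  rw [map_mul, map_mul, mul_apply_eq_comp, mul_apply_eq_comp,
    ← inner_starHom, ← e1] at e2
  refine e2.symm.trans ?_
  rw [show (fun x => ENNReal.ofReal (h x ^ 2)) = fun x => (((h x ^ 2).toNNReal : NNReal) : ℝ≥0∞)
    from rfl, integral_withDensity_eq_integral_smul hm]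
  refine integral_congr_ae (Eventually.of_forall fun x => ?_)
  simp only [NNReal.smul_def, Real.coe_toNNReal _ (sq_nonneg (h x))]
  simp
  ring

/-- The filter of continuous functions with values in `[0, 1]` that approximate the indicator of `B`
in `L¹` of all finite measures. -/
noncomputable def indicatorFilter (B : Set X) : Filter C(X, ℝ) :=
  ⨅ ν : FiniteMeasure X, 𝓟 {f | ∀ x, 0 ≤ f x ∧ f x ≤ 1} ⊓
    comap (fun f : C(X, ℝ) => ∫ x, |f x - B.indicator 1 x| ∂(ν : Measure X)) (𝓝 0)

omit [CompactSpace X] [BorelSpace X] in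
theorem eventually_indicatorFilter (B : Set X) :
    ∀ᶠ f in indicatorFilter B, ∀ x, 0 ≤ f x ∧ f x ≤ 1 :=
  mem_iInf_of_mem (0 : FiniteMeasure X) (mem_inf_of_left (mem_principal_self _))

omit [CompactSpace X] [BorelSpace X] in
theorem tendsto_indicatorFilter (B : Set X) (ν : Measure X) [IsFiniteMeasure ν] :
    Tendsto (fun f : C(X, ℝ) => ∫ x, |f x - B.indicator 1 x| ∂ν) (indicatorFilter B) (𝓝 0) :=
  tendsto_iff_comap.2 ((iInf_le _ (⟨ν, inferInstance⟩ : FiniteMeasure X)).trans inf_le_right)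

variable {B C : Set X}

theorem integrable_sub_indicator (hB : MeasurableSet B) (f : C(X, ℝ)) (ν : Measure X)
    [IsFiniteMeasure ν] : Integrable (fun x => |f x - B.indicator (1 : X → ℝ) x|) ν :=
  ((f.integrable_of_compactSpace ν).sub ((integrable_const (1 : ℝ)).indicator hB)).abs

omit [MetricSpace X] [CompactSpace X] [MeasurableSpace X] [BorelSpace X] in
theorem indicator_one_mem (B : Set X) (x : X) :
    0 ≤ B.indicator (1 : X → ℝ) x ∧ B.indicator (1 : X → ℝ) x ≤ 1 := by
  by_cases h : x ∈ B <;> simp [h]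

theorem exists_continuous_approx_indicator (hB : MeasurableSet B) (ν : Measure X)
    [IsFiniteMeasure ν] {ε : ℝ} (hε : 0 < ε) : ∃ f : C(X, ℝ), (∀ x, 0 ≤ f x ∧ f x ≤ 1) ∧
      ∫ x, |f x - B.indicator 1 x| ∂ν ≤ ε := by
  obtain ⟨g, hg, hgi⟩ := ((integrable_const (μ := ν) (1 : ℝ)).indicator hB
    ).exists_boundedContinuous_integral_sub_le hε
  -- Clamping to `[0, 1]` does not increase the distance to an indicator, whose values lie there.
  refine ⟨⟨fun x => max 0 (min 1 (g x)), by fun_prop⟩, fun x => ⟨le_max_left _ _, by simp⟩,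
    le_trans (integral_mono (integrable_sub_indicator hB _ ν)
      (((integrable_const (μ := ν) (1 : ℝ)).indicator hB).sub hgi).norm fun x => ?_) hg⟩
  have h := indicator_one_mem B x
  change |max 0 (min 1 (g x)) - B.indicator (fun _ => (1 : ℝ)) x| ≤
    ‖B.indicator (fun _ => (1 : ℝ)) x - g x‖
  rw [Real.norm_eq_abs, abs_sub_comm (B.indicator _ x)]
  change 0 ≤ B.indicator (fun _ => (1 : ℝ)) x ∧ B.indicator (fun _ => (1 : ℝ)) x ≤ 1 at h
  generalize B.indicator (fun _ => (1 : ℝ)) x = b at h ⊢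
  obtain ⟨h0, h1⟩ := h
  rw [abs_le]
  have ha := neg_abs_le (g x - b)
  have hb := le_abs_self (g x - b)
  constructor <;> rcases max_cases 0 (min 1 (g x)) with h | h <;>
    rcases min_cases 1 (g x) with h' | h' <;> linarith [abs_nonneg (g x - b)]

/-- The family is directed because the `L¹` error for `ν₁ + ν₂` dominates those for `ν₁` and `ν₂`;
for a single measure, continuous functions approximate the indicator. -/
theorem indicatorFilter_neBot (hB : MeasurableSet B) : (indicatorFilter B).NeBot := by
  refine iInf_neBot_of_directed' ?_ fun ν => ?_
  · intro ν₁ ν₂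
    have key : ∀ ν₁ ν₂ : FiniteMeasure X,
        𝓟 {f : C(X, ℝ) | ∀ x, 0 ≤ f x ∧ f x ≤ 1} ⊓ comap (fun f : C(X, ℝ) =>
          ∫ x, |f x - B.indicator 1 x| ∂((ν₁ + ν₂ : FiniteMeasure X) : Measure X)) (𝓝 0) ≤
        𝓟 {f | ∀ x, 0 ≤ f x ∧ f x ≤ 1} ⊓ comap (fun f : C(X, ℝ) =>
          ∫ x, |f x - B.indicator 1 x| ∂(ν₁ : Measure X)) (𝓝 0) := by
      intro ν₁ ν₂
      refine inf_le_inf_left _ (tendsto_iff_comap.1 ?_)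
      refine squeeze_zero (fun f => integral_nonneg fun x => abs_nonneg _) (fun f => ?_)
        tendsto_comap
      rw [FiniteMeasure.toMeasure_add, integral_add_measure (integrable_sub_indicator hB f _)
        (integrable_sub_indicator hB f _)]
      exact le_add_of_nonneg_right (integral_nonneg fun x => abs_nonneg _)
    exact ⟨ν₁ + ν₂, key ν₁ ν₂, add_comm ν₂ ν₁ ▸ key ν₂ ν₁⟩
  · rw [inf_comm, inf_principal_neBot_iff]
    rintro U ⟨t, ht, htU⟩
    obtain ⟨ε, hε, hεt⟩ := Metric.mem_nhds_iff.1 ht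
    obtain ⟨f, hf, hfε⟩ := exists_continuous_approx_indicator hB (ν : Measure X) (half_pos hε)
    refine ⟨f, htU (hεt ?_), hf⟩
    rw [Metric.mem_ball, Real.dist_0_eq_abs,
      abs_of_nonneg (integral_nonneg fun x => abs_nonneg _)]
    exact hfε.trans_lt (half_lt_self hε)

variable (X) in
theorem tendsto_integral_indicatorFilter (hB : MeasurableSet B) (ν : Measure X)
    [IsFiniteMeasure ν] :
    Tendsto (fun f : C(X, ℝ) => ∫ x, f x ∂ν) (indicatorFilter B) (𝓝 (ν.real B)) := by
  rw [tendsto_iff_dist_tendsto_zero]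
  refine squeeze_zero (fun f => dist_nonneg) (fun f => ?_) (tendsto_indicatorFilter B ν)
  have hi : Integrable (B.indicator (1 : X → ℝ)) ν := (integrable_const (1 : ℝ)).indicator hB
  rw [← integral_indicator_one hB, Real.dist_eq, ← integral_sub (f.integrable_of_compactSpace ν) hi]
  exact abs_integral_le_integral_abs

/-- Approximating along `indicatorFilter B` gives a limit for the functional calculus. -/
theorem exists_tendsto_starHom (hB : MeasurableSet B) (ξ : E) :
    ∃ v, Tendsto (fun f => Φ f ξ) (indicatorFilter B) (𝓝 v) := by
  have := indicatorFilter_neBot hB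
  rw [← cauchy_map_iff_exists_tendsto, cauchy_map_iff]
  refine ⟨this, ?_⟩
  rw [Metric.uniformity_eq_comap_nhds_zero, tendsto_comap_iff]
  have hU := eventually_indicatorFilter B
  have hT := tendsto_indicatorFilter B (diagMeasure Φ ξ)
  have hsum := (hT.comp tendsto_fst).add (hT.comp (tendsto_snd (f := indicatorFilter B)))
  rw [add_zero] at hsum
  -- The squared distance is `∫ (f - g)² dμ_ξ`, and `(f - g)² ≤ |f - g|` for values in `[0, 1]`, so
  -- `L¹` errors control it.
  have h2 : Tendsto (fun p : C(X, ℝ) × C(X, ℝ) => (dist (Φ p.1 ξ) (Φ p.2 ξ)) ^ 2)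
      (indicatorFilter B ×ˢ indicatorFilter B) (𝓝 0) := by
    refine squeeze_zero' (Eventually.of_forall fun p => sq_nonneg _) ?_ hsum
    filter_upwards [hU.prod_mk hU] with p ⟨h1, h2⟩
    rw [dist_eq_norm, ← _root_.sub_apply, ← map_sub, norm_sq_starHom_eq_integral]
    rw [Function.comp_apply, Function.comp_apply, ← integral_add (integrable_sub_indicator hB _ _)
      (integrable_sub_indicator hB _ _)]
    refine integral_mono ((p.1 - p.2).integrable_sq _)
      ((integrable_sub_indicator hB _ _).add (integrable_sub_indicator hB _ _)) fun x => ?_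
    change (p.1 x - p.2 x) ^ 2 ≤ |p.1 x - B.indicator 1 x| + |p.2 x - B.indicator 1 x|
    have ha := h1 x
    have hb := h2 x
    calc (p.1 x - p.2 x) ^ 2 ≤ |p.1 x - p.2 x| := by
          rw [← sq_abs, sq]
          exact mul_le_of_le_one_left (abs_nonneg _) (abs_le.2 ⟨by linarith, by linarith⟩)
      _ ≤ _ := by
          rw [abs_sub_comm (p.2 x)]
          exact abs_sub_le _ _ _
  have h3 := h2.sqrt
  rw [Real.sqrt_zero] at h3
  refine h3.congr fun p => ?_
  rw [Real.sqrt_sq dist_nonneg]; rfl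

theorem norm_starHom_le {f : C(X, ℝ)} (hf : ∀ x, 0 ≤ f x ∧ f x ≤ 1) (ξ : E) : ‖Φ f ξ‖ ≤ ‖ξ‖ := by
  refine le_of_sq_le_sq ?_ (norm_nonneg _)
  have h1 : ‖ξ‖ ^ 2 = ∫ x, (1 : ℝ) ^ 2 ∂diagMeasure Φ ξ := by
    have := norm_sq_starHom_eq_integral Φ 1 ξ
    rw [map_one] at this
    exact this
  rw [h1, norm_sq_starHom_eq_integral]
  refine integral_mono (f.integrable_sq _) (integrable_const _) fun x => ?_
  have := hf x
  exact pow_le_pow_left₀ this.1 this.2 2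

/-- The spectral projection `1_B(Φ)`. -/
noncomputable def borelProj (B : Set X) (hB : MeasurableSet B) : E →L[ℂ] E :=
  have := indicatorFilter_neBot hB
  LinearMap.mkContinuous
    { toFun := fun ξ => (exists_tendsto_starHom Φ hB ξ).choose
      map_add' := fun ξ η => tendsto_nhds_unique (exists_tendsto_starHom Φ hB (ξ + η)).choose_spec (by
        simpa using (exists_tendsto_starHom Φ hB ξ).choose_spec.add
          (exists_tendsto_starHom Φ hB η).choose_spec)
      map_smul' := fun c ξ => tendsto_nhds_unique (exists_tendsto_starHom Φ hB (c • ξ)).choose_spec (by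
        simpa using (exists_tendsto_starHom Φ hB ξ).choose_spec.const_smul c) } 1
    (fun ξ => by
      rw [one_mul]
      refine le_of_tendsto (exists_tendsto_starHom Φ hB ξ).choose_spec.norm ?_
      filter_upwards [eventually_indicatorFilter B] with f hf
      exact norm_starHom_le Φ hf ξ)

theorem tendsto_borelProj (hB : MeasurableSet B) (ξ : E) :
    Tendsto (fun f => Φ f ξ) (indicatorFilter B) (𝓝 (borelProj Φ B hB ξ)) :=
  (exists_tendsto_starHom Φ hB ξ).choose_spec

theorem borelProj_symm (hB : MeasurableSet B) (ξ η : E) :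
    ⟪borelProj Φ B hB ξ, η⟫_ℂ = ⟪ξ, borelProj Φ B hB η⟫_ℂ := by
  have := indicatorFilter_neBot hB
  have h1 := (tendsto_borelProj Φ hB ξ).inner (𝕜 := ℂ) (tendsto_const_nhds (x := η))
  have h2 := (tendsto_const_nhds (x := ξ)).inner (𝕜 := ℂ) (tendsto_borelProj Φ hB η)
  simp only [inner_starHom] at h1
  exact tendsto_nhds_unique h1 h2

/-- Products of approximants of `1_B` and `1_C` approximate `1_{B ∩ C}`: with all values in `[0,
1]`, the errors add. The operator identity then follows by taking limits in inner products. -/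
theorem borelProj_mul (hB : MeasurableSet B) (hC : MeasurableSet C) :
    borelProj Φ (B ∩ C) (hB.inter hC) = borelProj Φ B hB * borelProj Φ C hC := by
  have := indicatorFilter_neBot hB
  have := indicatorFilter_neBot hC
  have hmul : Tendsto (fun p : C(X, ℝ) × C(X, ℝ) => p.1 * p.2)
      (indicatorFilter B ×ˢ indicatorFilter C) (indicatorFilter (B ∩ C)) := by
    have hU := (eventually_indicatorFilter B).prod_mk (eventually_indicatorFilter C)
    refine tendsto_iInf.2 fun ν => tendsto_inf.2 ⟨tendsto_principal.2 ?_, tendsto_comap_iff.2 ?_⟩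
    · filter_upwards [hU] with p ⟨h1, h2⟩ x
      exact ⟨mul_nonneg (h1 x).1 (h2 x).1, mul_le_one₀ (h1 x).2 (h2 x).1 (h2 x).2⟩
    · have hsum := ((tendsto_indicatorFilter B (ν : Measure X)).comp tendsto_fst).add
        ((tendsto_indicatorFilter C (ν : Measure X)).comp (tendsto_snd (f := indicatorFilter B)))
      rw [add_zero] at hsum
      refine squeeze_zero' (Eventually.of_forall fun p => integral_nonneg fun x => abs_nonneg _) ?_
        hsum
      filter_upwards [hU] with p ⟨h1, h2⟩
      change _ ≤ (∫ x, |p.1 x - B.indicator 1 x| ∂(ν : Measure X)) +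
        ∫ x, |p.2 x - C.indicator 1 x| ∂(ν : Measure X)
      rw [← integral_add (integrable_sub_indicator hB _ _) (integrable_sub_indicator hC _ _)]
      refine integral_mono (integrable_sub_indicator (hB.inter hC) _ _)
        ((integrable_sub_indicator hB _ _).add (integrable_sub_indicator hC _ _)) fun x => ?_
      have hi : (B ∩ C).indicator (1 : X → ℝ) x = B.indicator 1 x * C.indicator 1 x := by
        by_cases hb : x ∈ B <;> by_cases hc : x ∈ C <;> simp [hb, hc]
      change |p.1 x * p.2 x - (B ∩ C).indicator 1 x| ≤
        |p.1 x - B.indicator 1 x| + |p.2 x - C.indicator 1 x|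
      have hb := indicator_one_mem B x
      rw [hi, show p.1 x * p.2 x - B.indicator 1 x * C.indicator 1 x =
        (p.1 x - B.indicator 1 x) * p.2 x + B.indicator 1 x * (p.2 x - C.indicator 1 x) by ring]
      refine (abs_add_le _ _).trans (add_le_add ?_ ?_)
      · rw [abs_mul, abs_of_nonneg (h2 x).1]
        exact mul_le_of_le_one_right (abs_nonneg _) (h2 x).2
      · rw [abs_mul, abs_of_nonneg hb.1]
        exact mul_le_of_le_one_left (abs_nonneg _) hb.2
  ext ξ
  refine ext_inner_left ℂ fun η => ?_
  rw [mul_apply_eq_comp]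
  change _ = ⟪η, borelProj Φ B hB (borelProj Φ C hC ξ)⟫_ℂ
  rw [← borelProj_symm Φ hB]
  have h1 := ((tendsto_borelProj Φ hB η).comp (tendsto_fst (g := indicatorFilter C))).inner (𝕜 := ℂ)
    ((tendsto_borelProj Φ hC ξ).comp (tendsto_snd (f := indicatorFilter B)))
  have h2 := (tendsto_const_nhds (x := η)).inner (𝕜 := ℂ)
    ((tendsto_borelProj Φ (hB.inter hC) ξ).comp hmul)
  refine tendsto_nhds_unique h2 (h1.congr fun p => ?_)
  simp only [Function.comp_apply, map_mul, mul_apply_eq_comp, inner_starHom]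

theorem borelProj_univ : borelProj Φ Set.univ MeasurableSet.univ = 1 := by
  ext ξ
  -- The constant `1` has zero error for every measure, so the limit may be taken along it alone.
  have h : pure (1 : C(X, ℝ)) ≤ indicatorFilter (Set.univ : Set X) :=
    le_iInf fun ν => le_inf (by simp) (by
      rw [← tendsto_iff_comap]
      refine tendsto_pure_left.2 fun s hs => ?_
      simpa using mem_of_mem_nhds hs)
  refine tendsto_nhds_unique ((tendsto_borelProj Φ MeasurableSet.univ ξ).mono_left h) ?_
  simpa using tendsto_pure_nhds (fun f => Φ f ξ) 1

theorem norm_sq_borelProj (hB : MeasurableSet B) (ξ : E) :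
    ‖borelProj Φ B hB ξ‖ ^ 2 = (diagMeasure Φ ξ).real B := by
  have := indicatorFilter_neBot hB
  have h1 := (tendsto_const_nhds (x := ξ)).inner (𝕜 := ℂ) (tendsto_borelProj Φ hB ξ)
  have h2 := (Complex.continuous_re.tendsto _).comp h1
  simp only [Function.comp_def, ← integral_diagMeasure] at h2
  rw [← tendsto_nhds_unique h2 (tendsto_integral_indicatorFilter X hB _)]
  have h3 := borelProj_mul Φ hB hB
  simp only [Set.inter_self] at h3
  conv_rhs => rw [h3]
  rw [mul_apply_eq_comp, ← borelProj_symm, inner_self_eq_norm_sq_to_K]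
  norm_cast

/-- The vectors `v n` are orthogonal components of `u`, so `‖u - ∑ v n‖² = ‖u‖² - ∑ ‖v n‖²` for
finite sums. The right side tends to `0` by countable additivity of `diagMeasure`. -/
theorem hasSum_borelProj {B : ℕ → Set X} (hB : ∀ n, MeasurableSet (B n))
    (hd : Pairwise (Function.onFun Disjoint B)) (ξ : E) :
    HasSum (fun n => borelProj Φ (B n) (hB n) ξ)
      (borelProj Φ (⋃ n, B n) (MeasurableSet.iUnion hB) ξ) := by
  set u := borelProj Φ (⋃ n, B n) (MeasurableSet.iUnion hB) ξ
  set v := fun n => borelProj Φ (B n) (hB n) ξ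
  have hcomp : ∀ {C D : Set X} (hC : MeasurableSet C) (hD : MeasurableSet D) (hCD : C ⊆ D),
      ⟪borelProj Φ D hD ξ, borelProj Φ C hC ξ⟫_ℂ = ((‖borelProj Φ C hC ξ‖ ^ 2 : ℝ) : ℂ) := by
    intro C D hC hD hCD
    have h1 := borelProj_mul Φ hC hD
    simp only [Set.inter_eq_left.2 hCD] at h1
    have h2 := borelProj_mul Φ hC hC
    simp only [Set.inter_self] at h2
    conv_lhs => rw [h2]
    rw [mul_apply_eq_comp, ← borelProj_symm, ← mul_apply_eq_comp, ← h1, inner_self_eq_norm_sq_to_K]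
    norm_cast
  have huv : ∀ n, ⟪u, v n⟫_ℂ = ((‖v n‖ ^ 2 : ℝ) : ℂ) := fun n =>
    hcomp (hB n) _ (Set.subset_iUnion B n)
  have hvv : ∀ m n, m ≠ n → ⟪v m, v n⟫_ℂ = 0 := by
    intro m n hmn
    have h1 := norm_sq_borelProj Φ ((hB m).inter (hB n)) ξ
    rw [borelProj_symm, ← mul_apply_eq_comp, ← borelProj_mul]
    simp only [Set.disjoint_iff_inter_eq_empty.1 (hd hmn), measureReal_empty] at h1 ⊢
    rw [norm_eq_zero.1 (pow_eq_zero_iff two_ne_zero |>.1 h1), inner_zero_right]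
  have hnorm : ∀ s : Finset ℕ, ‖u - ∑ n ∈ s, v n‖ ^ 2 = ‖u‖ ^ 2 - ∑ n ∈ s, ‖v n‖ ^ 2 := by
    intro s
    induction s using Finset.induction_on with
    | empty => simp
    | insert a s ha ih =>
      have h1 : ⟪u - ∑ n ∈ s, v n, v a⟫_ℂ = ((‖v a‖ ^ 2 : ℝ) : ℂ) := by
        rw [inner_sub_left, huv, sum_inner, Finset.sum_eq_zero, sub_zero]
        exact fun n hn => hvv n a fun h => ha (h ▸ hn)
      rw [Finset.sum_insert ha, Finset.sum_insert ha, add_comm (v a), ← sub_sub, @norm_sub_sq ℂ, h1, ih]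
      simp only [RCLike.re_to_complex, Complex.ofReal_re]
      ring
  have hsum : HasSum (fun n => ‖v n‖ ^ 2) (‖u‖ ^ 2) := by
    simp only [u, v, norm_sq_borelProj]
    have := VectorMeasure.m_iUnion (diagMeasure Φ ξ).toSignedMeasure hB hd
    simpa only [Measure.toSignedMeasure_apply_measurable (hB _),
      Measure.toSignedMeasure_apply_measurable (MeasurableSet.iUnion hB)] using this
  have h1 : Tendsto (fun s : Finset ℕ => ‖u - ∑ n ∈ s, v n‖ ^ 2) atTop (𝓝 0) := by
    simp only [hnorm]
    have := (tendsto_const_nhds (x := ‖u‖ ^ 2)).sub hsum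
    rwa [sub_self] at this
  have h2 := h1.sqrt
  simp only [Real.sqrt_zero, Real.sqrt_sq (norm_nonneg _)] at h2
  refine tendsto_iff_norm_sub_tendsto_zero.2 (h2.congr fun s => norm_sub_rev _ _)

open Classical in
/-- The projection-valued measure on `ℝ` of a functional calculus, transported along `g`. -/
noncomputable def spectralMeasure (g : X → ℝ) (hg : Measurable g) : ProjectionMeasure E where
  proj B := if hB : MeasurableSet B then borelProj Φ (g ⁻¹' B) (hg hB) else 0
  isStarProjection B hB := by
    rw [dif_pos hB]
    refine ⟨?_, ?_⟩
    · have := borelProj_mul Φ (hg hB) (hg hB)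
      simp only [Set.inter_self] at this
      exact this.symm
    · rw [ContinuousLinearMap.isSelfAdjoint_iff_isSymmetric]
      exact borelProj_symm Φ (hg hB)
  proj_univ := by
    rw [dif_pos MeasurableSet.univ]
    exact borelProj_univ Φ
  proj_inter B C hB hC := by
    rw [dif_pos hB, dif_pos hC, dif_pos (hB.inter hC)]
    exact borelProj_mul Φ (hg hB) (hg hC)
  hasSum_iUnion B hB hd ξ := by
    simp only [dif_pos (hB _), dif_pos (MeasurableSet.iUnion hB), Set.preimage_iUnion]
    exact hasSum_borelProj Φ (fun n => hg (hB n)) (fun m n hmn => (hd hmn).preimage g) ξ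

theorem scalarMeasure_spectralMeasure {g : X → ℝ} (hg : Measurable g) (ξ : E) :
    (spectralMeasure Φ g hg).scalarMeasure ξ = (diagMeasure Φ ξ).map g := by
  ext B hB
  rw [ProjectionMeasure.scalarMeasure_apply _ _ hB, Measure.map_apply hg hB]
  have : (spectralMeasure Φ g hg).proj B = borelProj Φ (g ⁻¹' B) (hg hB) := dif_pos hB
  rw [this, norm_sq_borelProj, measureReal_def, ENNReal.ofReal_toReal (measure_ne_top _ _)]

end FunctionalCalculus

/-! ### The positive square root -/

section BoundedResolvent

variable {F : Type*} [NormedAddCommGroup F] [InnerProductSpace ℂ F] [CompleteSpace F]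
  {A : F →ₗ.[ℂ] F} {R : F →L[ℂ] F}

omit [CompleteSpace F] in
theorem dense_range_of_graph (hAR : ∀ x y, (x, y) ∈ A.graph ↔ R (x + y) = x)
    (hdense : Dense (A.domain : Set F)) : DenseRange R := by
  refine hdense.mono fun x hx => ?_
  exact ⟨_, (hAR _ _).1 (A.mem_graph ⟨x, hx⟩)⟩

theorem spectrum_mem_Icc (h0 : 0 ≤ R) (h1 : R ≤ 1) {x : ℝ} (hx : x ∈ spectrum ℝ R) :
    0 ≤ x ∧ x ≤ 1 := by
  refine ⟨spectrum_nonneg_of_nonneg h0 hx, ?_⟩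
  exact (le_algebraMap_iff_spectrum_le (r := (1 : ℝ)) (a := R) (IsSelfAdjoint.of_nonneg h0)).1
    (by simpa using h1) x hx

/-- The positive square root of `A = R⁻¹ - 1` is `(1 - R)^{1/2} R^{-1/2}`. -/
theorem exists_isPositiveSqrt (h0 : 0 ≤ R) (h1 : R ≤ 1)
    (hAR : ∀ x y, (x, y) ∈ A.graph ↔ R (x + y) = x) (hdense : Dense (A.domain : Set F)) :
    ∃ S, IsPositiveSqrt S A := by
  have hsa : IsSelfAdjoint R := IsSelfAdjoint.of_nonneg h0
  set b : F →L[ℂ] F := cfc (fun x : ℝ => √x) R with hb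
  set a : F →L[ℂ] F := cfc (fun x : ℝ => √(1 - x)) R with ha
  have hbb : b * b = R := by
    rw [hb, ← cfc_mul _ _ R, cfc_congr (g := fun x : ℝ => x) fun x hx =>
      Real.mul_self_sqrt (spectrum_mem_Icc h0 h1 hx).1, cfc_id' ℝ R]
  have haa : a * a = 1 - R := by
    rw [ha, ← cfc_mul _ _ R, cfc_congr (g := fun x : ℝ => 1 - x) fun x hx =>
      Real.mul_self_sqrt (sub_nonneg.2 (spectrum_mem_Icc h0 h1 hx).2), cfc_sub _ _ R,
      cfc_const_one ℝ R, cfc_id' ℝ R]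
  have hab : a * b = b * a := cfc_commute_cfc _ _ R
  have hbsa : ∀ x y, ⟪b x, y⟫_ℂ = ⟪x, b y⟫_ℂ := fun x y => by
    rw [← ContinuousLinearMap.adjoint_inner_right, ← ContinuousLinearMap.star_eq_adjoint,
      (cfc_predicate (fun x : ℝ => √x) R : IsSelfAdjoint b).star_eq]
  have hasa : ∀ x y, ⟪a x, y⟫_ℂ = ⟪x, a y⟫_ℂ := fun x y => by
    rw [← ContinuousLinearMap.adjoint_inner_right, ← ContinuousLinearMap.star_eq_adjoint,
      (cfc_predicate (fun x : ℝ => √(1 - x)) R : IsSelfAdjoint a).star_eq]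
  have hpos : 0 ≤ b * a := Commute.mul_nonneg
    (cfc_nonneg fun x _ => Real.sqrt_nonneg _) (cfc_nonneg fun x _ => Real.sqrt_nonneg _) hab.symm
  have hbb' : ∀ x, b (b x) = R x := fun x => by rw [← hbb]; rfl
  have haa' : ∀ x, a (a x) = x - R x := fun x => by
    rw [← mul_apply_eq_comp, haa]; rfl
  have hab' : ∀ x, a (b x) = b (a x) := fun x => by
    rw [← mul_apply_eq_comp, hab]; rfl
  have hRinj : ∀ x, R x = 0 → x = 0 := fun x hx =>
    A.graph_fst_eq_zero_snd (x := 0) ((hAR 0 x).2 (by rw [zero_add, hx])) rfl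
  have hbinj : ∀ x, b x = 0 → x = 0 := fun x hx => hRinj x (by rw [← hbb', hx, map_zero])
  -- The graph `{(bx, ax)}` of `a b⁻¹`, single-valued because `b` is injective.
  let g : Submodule ℂ (F × F) := LinearMap.range ((b.prod a : F →L[ℂ] F × F) : F →ₗ[ℂ] F × F)
  let S : F →ₗ.[ℂ] F := g.toLinearPMap
  have hS : ∀ u v, (u, v) ∈ S.graph ↔ ∃ x, b x = u ∧ a x = v := by
    intro u v
    rw [Submodule.toLinearPMap_graph_eq]
    · constructor
      · rintro ⟨x, hx⟩
        exact ⟨x, congrArg Prod.fst hx, congrArg Prod.snd hx⟩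
      · rintro ⟨x, rfl, rfl⟩
        exact ⟨x, rfl⟩
    · rintro _ ⟨x, rfl⟩ hx
      change a x = 0
      rw [hbinj x hx, map_zero]
  have hSd : Dense (S.domain : Set F) := by
    refine hdense.mono fun x hx => ?_
    have h := (hAR _ _).1 (A.mem_graph ⟨x, hx⟩)
    exact LinearPMap.mem_domain_of_mem_graph ((hS x _).2 ⟨b (x + A ⟨x, hx⟩), by rw [hbb', h], rfl⟩)
  refine ⟨S, ?_, ?_, ?_⟩
  · rw [LinearPMap.isSelfAdjoint_def]
    apply LinearPMap.eq_of_eq_graph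
    ext ⟨y, z⟩
    rw [mem_graph_adjoint hSd, hS]
    constructor
    · intro h
      have e : a y = b z := by
        refine ext_inner_left ℂ fun x => ?_
        rw [← hasa, ← hbsa]
        exact h _ _ ((hS _ _).2 ⟨x, rfl, rfl⟩)
      -- The witness solves `bw = y`, `aw = z`, by `ay = bz` and `a² + b² = 1`.
      refine ⟨a z + b y, ?_, ?_⟩
      · rw [map_add, ← hab', ← e, haa', hbb', sub_add_cancel]
      · rw [map_add, haa', hab', e, hbb', sub_add_cancel]
    · rintro ⟨w, rfl, rfl⟩ x z hx
      obtain ⟨v, rfl, rfl⟩ := (hS _ _).1 hx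
      rw [hasa, hbsa, hab']
  · rintro ⟨x, hx⟩
    obtain ⟨w, h1, h2⟩ := (hS _ _).1 (S.mem_graph ⟨x, hx⟩)
    rw [← h2]
    change 0 ≤ (⟪x, a w⟫_ℂ).re
    rw [show x = b w from h1.symm, hbsa]
    exact ((ContinuousLinearMap.nonneg_iff_isPositive _).1 hpos).re_inner_nonneg_right w
  · apply LinearPMap.eq_of_eq_graph
    ext ⟨x, z⟩
    rw [mem_graph_opComp, hAR]
    constructor
    · rintro ⟨y, h1, h2⟩
      obtain ⟨u, rfl, rfl⟩ := (hS _ _).1 h1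
      obtain ⟨w, h3, rfl⟩ := (hS _ _).1 h2
      rw [← hbb', map_add b, hbb', ← hab', h3, haa', add_sub_cancel]
    · intro h
      refine ⟨a (b (x + z)), (hS _ _).2 ⟨b (x + z), by rw [hbb', h], rfl⟩,
        (hS _ _).2 ⟨a (x + z), (hab' _).symm, ?_⟩⟩
      rw [haa', h]; abel

end BoundedResolvent

/-! ### The spectral theorem for `A = R⁻¹ - 1` -/

section SpectralTheorem

open Filter Topology

variable {F : Type*} [NormedAddCommGroup F] [InnerProductSpace ℂ F] [CompleteSpace F]
  {A : F →ₗ.[ℂ] F} {R : F →L[ℂ] F}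

theorem IsSelfAdjoint.inner_graph (hA : IsSelfAdjoint A) {x y x' y' : F}
    (h : (x, y) ∈ A.graph) (h' : (x', y') ∈ A.graph) : ⟪y, x'⟫_ℂ = ⟪x, y'⟫_ℂ := by
  rw [← LinearPMap.isSelfAdjoint_def.1 hA, mem_graph_adjoint hA.dense_domain] at h'
  exact h' _ _ h

theorem IsSelfAdjoint.inner_graph_self_im (hA : IsSelfAdjoint A) {x y : F}
    (h : (x, y) ∈ A.graph) : ((⟪x, y⟫_ℂ).re : ℂ) = ⟪x, y⟫_ℂ := by
  rw [← Complex.conj_eq_iff_re, inner_conj_symm, hA.inner_graph h h]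

/-- The identity function on the spectrum. -/
def spectrumId (R : F →L[ℂ] F) : C(spectrum ℝ R, ℝ) := ⟨Subtype.val, continuous_subtype_val⟩

section

variable (hR : IsSelfAdjoint R)

theorem cfcHom_spectrumId : cfcHom hR (spectrumId R) = R := cfcHom_id hR

theorem diagMeasure_apply_self (η : F) : diagMeasure (cfcHom hR) (R η) =
    (diagMeasure (cfcHom hR) η).withDensity fun x => ENNReal.ofReal ((x : ℝ) ^ 2) := by
  have := diagMeasure_starHom (cfcHom hR) (spectrumId R) η
  rwa [cfcHom_spectrumId] at this

omit [CompleteSpace F] in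
theorem measurableSet_spectrum_zero : MeasurableSet {x : spectrum ℝ R | (x : ℝ) = 0} :=
  measurable_subtype_coe (measurableSet_singleton (0 : ℝ))

/-- The projection for `{0}` kills the range of `R`, where the density `x²` vanishes at `0`; by
density of the range it is zero. -/
theorem diagMeasure_zero_of_denseRange (hd : DenseRange R) (ξ : F) :
    diagMeasure (cfcHom hR) ξ {x | (x : ℝ) = 0} = 0 := by
  have hZ := measurableSet_spectrum_zero (R := R)
  have h1 : ∀ ξ, borelProj (cfcHom hR) _ hZ ξ = 0 := by
    refine congrFun (hd.equalizer (borelProj (cfcHom hR) _ hZ).continuous continuous_const ?_)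
    funext η
    have h := norm_sq_borelProj (cfcHom hR) hZ (R η)
    rw [diagMeasure_apply_self, measureReal_def, withDensity_apply _ hZ,
      setLIntegral_congr_fun (g := fun _ => 0) hZ (fun x hx => by
        simp only [Set.mem_ofPred_eq] at hx; simp [hx])] at h
    simpa using h
  have h2 := norm_sq_borelProj (cfcHom hR) hZ ξ
  rw [h1, norm_zero, zero_pow two_ne_zero, eq_comm, measureReal_eq_zero_iff] at h2
  exact h2

theorem integral_diagMeasure_apply_self (η : F) (h : spectrum ℝ R → ℝ) :
    ∫ x, h x ∂diagMeasure (cfcHom hR) (R η) =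
      ∫ x : spectrum ℝ R, (x : ℝ) ^ 2 * h x ∂diagMeasure (cfcHom hR) η := by
  rw [diagMeasure_apply_self, integral_withDensity_eq_integral_toReal_smul (by fun_prop)
    (by simp)]
  simp [ENNReal.toReal_ofReal (sq_nonneg _)]

theorem integrable_diagMeasure_apply_self (η : F) (h : spectrum ℝ R → ℝ) :
    Integrable h (diagMeasure (cfcHom hR) (R η)) ↔
      Integrable (fun x : spectrum ℝ R => (x : ℝ) ^ 2 * h x) (diagMeasure (cfcHom hR) η) := by
  rw [diagMeasure_apply_self, integrable_withDensity_iff_integrable_smul' (by fun_prop)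
    (by simp)]
  simp [ENNReal.toReal_ofReal (sq_nonneg _)]

/-- If `∫ x⁻² dμ_ξ < ∞` then `|⟨ξ, y⟩| ≤ C ‖R y‖`. -/
theorem exists_inner_le_of_integrable_inv_sq (hd : DenseRange R) {ξ : F}
    (hpos : ∀ x ∈ spectrum ℝ R, 0 ≤ x)
    (hi : Integrable (fun x : spectrum ℝ R => ((x : ℝ)⁻¹) ^ 2) (diagMeasure (cfcHom hR) ξ)) :
    ∃ C, ∀ y, ‖⟪ξ, y⟫_ℂ‖ ≤ C * ‖R y‖ := by
  set M := ∫ x : spectrum ℝ R, ((x : ℝ)⁻¹) ^ 2 ∂diagMeasure (cfcHom hR) ξ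
  have hM : 0 ≤ M := integral_nonneg fun x => sq_nonneg _
  have hae : ∀ᵐ x : spectrum ℝ R ∂diagMeasure (cfcHom hR) ξ, 0 < (x : ℝ) := by
    have h := diagMeasure_zero_of_denseRange hR hd ξ
    rw [measure_eq_zero_iff_ae_notMem] at h
    filter_upwards [h] with x hx
    exact lt_of_le_of_ne (hpos x x.2) fun h => hx h.symm
  have hε : ∀ n : ℕ, 0 < 1 / ((n : ℝ) + 1) := fun n => Nat.one_div_pos_of_nat
  -- Continuous truncations of `x⁻¹`: `f n (R) ξ` stays bounded while `(f n)(R) R ξ → ξ`. Moving `R`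
  -- to the other side of `⟨(f n)(R) R ξ, y⟩` gives the bound.
  let f : ℕ → C(spectrum ℝ R, ℝ) := fun n => ⟨fun x => (max (x : ℝ) (1 / ((n : ℝ) + 1)))⁻¹,
    Continuous.inv₀ (by fun_prop) fun x => (lt_max_of_lt_right (hε n)).ne'⟩
  have hf1 : ∀ n, ‖cfcHom hR (f n) ξ‖ ≤ √M := by
    intro n
    refine Real.le_sqrt_of_sq_le ?_
    rw [norm_sq_starHom_eq_integral]
    refine integral_mono_ae ((f n).integrable_sq _) hi ?_
    filter_upwards [hae] with x hx
    exact pow_le_pow_left₀ (inv_nonneg.2 (hx.le.trans (le_max_left _ _)))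
      (inv_anti₀ hx (le_max_left _ _)) 2
  have hf2 : ∀ n : ℕ, ‖cfcHom hR (f n * spectrumId R) ξ - ξ‖ ≤ 1 / ((n : ℝ) + 1) * √M := by
    intro n
    refine le_of_sq_le_sq ?_ (by have := hε n; positivity)
    have h1 : cfcHom hR (f n * spectrumId R) ξ - ξ = cfcHom hR (f n * spectrumId R - 1) ξ := by
      rw [map_sub, map_one]; rfl
    rw [h1, norm_sq_starHom_eq_integral, mul_pow, Real.sq_sqrt hM, ← integral_const_mul]
    refine integral_mono_ae ((f n * spectrumId R - 1).integrable_sq _) (hi.const_mul _) ?_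
    filter_upwards [hae] with x hx
    change ((max (x : ℝ) (1 / ((n : ℝ) + 1)))⁻¹ * (x : ℝ) - 1) ^ 2 ≤
      (1 / ((n : ℝ) + 1)) ^ 2 * ((x : ℝ)⁻¹) ^ 2
    have hn := hε n
    generalize 1 / ((n : ℝ) + 1) = ε at hn ⊢
    rcases le_total ε (x : ℝ) with h | h
    · rw [max_eq_left h, inv_mul_cancel₀ hx.ne', sub_self, zero_pow two_ne_zero]
      positivity
    · rw [max_eq_right h, ← mul_pow, sq_le_sq]
      have h2 : ε⁻¹ * (x : ℝ) ≤ 1 := by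
        rw [inv_mul_le_iff₀ hn]; simpa using h
      have h3 : 1 ≤ ε * (x : ℝ)⁻¹ := by
        rw [← div_eq_mul_inv, le_div_iff₀ hx]; simpa using h
      have h4 : 0 ≤ ε⁻¹ * (x : ℝ) := by positivity
      rw [abs_of_nonpos (by linarith), abs_of_nonneg (by positivity)]
      linarith
  have hlim : Tendsto (fun n => cfcHom hR (f n * spectrumId R) ξ) atTop (𝓝 ξ) := by
    rw [tendsto_iff_norm_sub_tendsto_zero]
    refine squeeze_zero (fun n => norm_nonneg _) hf2 ?_
    simpa using tendsto_one_div_add_atTop_nhds_zero_nat.mul_const (√M)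
  refine ⟨√M, fun y => ?_⟩
  refine le_of_tendsto (hlim.inner (𝕜 := ℂ) (tendsto_const_nhds (x := y))).norm
    (Eventually.of_forall fun n => ?_)
  rw [mul_comm, map_mul, mul_apply_eq_comp, inner_starHom, cfcHom_spectrumId]
  exact (norm_inner_le_norm _ _).trans (mul_le_mul_of_nonneg_right (hf1 n) (norm_nonneg _))

end

/-- **Spectral theorem** for a positive self-adjoint operator `A = R⁻¹ - 1`. -/
theorem exists_isSpectralMeasureOf (h0 : 0 ≤ R) (h1 : R ≤ 1)
    (hAR : ∀ x y, (x, y) ∈ A.graph ↔ R (x + y) = x) (hA : IsSelfAdjoint A) :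
    ∃ Q : ProjectionMeasure F, Q.IsSpectralMeasureOf A := by
  have hR : IsSelfAdjoint R := IsSelfAdjoint.of_nonneg h0
  have hd := dense_range_of_graph hAR hA.dense_domain
  -- At `x = 0` this function has the default value `-1`, harmless since `{0}` is null for every
  -- `diagMeasure`.
  have hg : Measurable fun x : spectrum ℝ R => (x : ℝ)⁻¹ - 1 := by fun_prop
  have hsc := scalarMeasure_spectralMeasure (cfcHom hR) hg
  refine ⟨spectralMeasure (cfcHom hR) _ hg, fun ξ => ?_, fun ⟨ξ, hξ⟩ => ?_⟩
  · rw [hsc, integrable_map_measure (by fun_prop) hg.aemeasurable]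
    constructor
    · intro hξ
      have h := (hAR _ _).1 (A.mem_graph ⟨ξ, hξ⟩)
      simp only at h
      rw [← h, integrable_diagMeasure_apply_self]
      -- The integrand is `(1 - x)²` for `0 < x ≤ 1` and `0` at `0`; the bound `4` is generous.
      refine Integrable.of_bound (C := 4) (by fun_prop) (Eventually.of_forall fun x => ?_)
      obtain ⟨hx0, hx1⟩ := spectrum_mem_Icc h0 h1 x.2
      have : (x : ℝ) ^ 2 * ((x : ℝ)⁻¹ - 1) ^ 2 = ((x : ℝ) * (x : ℝ)⁻¹ - x) ^ 2 := by ring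
      rw [Function.comp_apply, this, Real.norm_eq_abs, abs_of_nonneg (sq_nonneg _)]
      rcases eq_or_ne (x : ℝ) 0 with hx | hx
      · simp [hx]
      · rw [mul_inv_cancel₀ hx]; nlinarith
    · intro hi
      have h2 : MemLp (fun x : spectrum ℝ R => (x : ℝ)⁻¹ - 1) 2 (diagMeasure (cfcHom hR) ξ) :=
        (memLp_two_iff_integrable_sq hg.aestronglyMeasurable).2 hi
      have h3 := (h2.add (memLp_const (1 : ℝ))).integrable_sq
      simp only [Pi.add_apply, sub_add_cancel] at h3
      obtain ⟨C, hC⟩ := exists_inner_le_of_integrable_inv_sq hR hd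
        (fun x hx => (spectrum_mem_Icc h0 h1 hx).1) h3
      -- As `A = A*`, it suffices to bound `⟨ξ, Az⟩` by `‖z‖`; this uses `R(z + Az) = z`.
      rw [← LinearPMap.isSelfAdjoint_def.1 hA, LinearPMap.mem_adjoint_domain_iff]
      refine AddMonoidHomClass.continuous_of_bound _ (C + ‖ξ‖) fun z => ?_
      have h4 := (hAR _ _).1 (A.mem_graph z)
      have h5 := hC (z + A z)
      rw [h4] at h5
      have h6 : ⟪ξ, A z⟫_ℂ = ⟪ξ, (z : F) + A z⟫_ℂ - ⟪ξ, (z : F)⟫_ℂ := by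
        rw [inner_add_right]; ring
      change ‖⟪ξ, A z⟫_ℂ‖ ≤ _
      rw [h6, add_mul]
      exact (norm_sub_le _ _).trans (add_le_add h5 (norm_inner_le_norm _ _))
  · have hgr := A.mem_graph ⟨ξ, hξ⟩
    have h := (hAR _ _).1 hgr
    simp only at h
    rw [hsc, integral_map hg.aemeasurable (by fun_prop), ← hA.inner_graph_self_im hgr]
    congr 1
    have hη : A ⟨ξ, hξ⟩ = (ξ + A ⟨ξ, hξ⟩) - R (ξ + A ⟨ξ, hξ⟩) := by rw [h]; abel
    rw [hη]
    set η := ξ + A ⟨ξ, hξ⟩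
    have e := integral_diagMeasure (cfcHom hR) η (spectrumId R * (1 - spectrumId R))
    rw [map_mul, mul_apply_eq_comp, ← inner_starHom, map_sub, map_one, cfcHom_spectrumId] at e
    change _ = (⟪R η, η - R η⟫_ℂ).re at e
    change (⟪ξ, η - R η⟫_ℂ).re =
      ∫ x : spectrum ℝ R, ((x : ℝ)⁻¹ - 1) ∂diagMeasure (cfcHom hR) ξ
    conv_rhs => rw [← h]
    rw [integral_diagMeasure_apply_self]
    conv_lhs => rw [← h]
    rw [← e]
    refine integral_congr_ae (Eventually.of_forall fun x => ?_)
    change (x : ℝ) * (1 - (x : ℝ)) = (x : ℝ) ^ 2 * ((x : ℝ)⁻¹ - 1)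
    rcases eq_or_ne (x : ℝ) 0 with hx | hx
    · simp [hx]
    · field_simp

end SpectralTheorem

/-! ### Properties of an arbitrary spectral measure of `A` -/

section SpectralMeasures

open Filter Topology

namespace ProjectionMeasure

variable {F : Type*} [NormedAddCommGroup F] [InnerProductSpace ℂ F] [CompleteSpace F]
  (Q : ProjectionMeasure F) {A : F →ₗ.[ℂ] F} {B C : Set ℝ}

instance (ξ : F) : IsFiniteMeasure (Q.scalarMeasure ξ) :=
  ⟨by rw [Q.scalarMeasure_apply ξ MeasurableSet.univ]; exact ENNReal.ofReal_lt_top⟩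

theorem scalarMeasure_real (ξ : F) (hB : MeasurableSet B) :
    (Q.scalarMeasure ξ).real B = ‖Q.proj B ξ‖ ^ 2 := by
  rw [measureReal_def, Q.scalarMeasure_apply ξ hB, ENNReal.toReal_ofReal (sq_nonneg _)]

theorem proj_proj (hB : MeasurableSet B) (hC : MeasurableSet C) (ξ : F) :
    Q.proj B (Q.proj C ξ) = Q.proj (B ∩ C) ξ := by
  rw [Q.proj_inter B C hB hC]; rfl

theorem inner_proj (hB : MeasurableSet B) (ξ η : F) :
    ⟪Q.proj B ξ, η⟫_ℂ = ⟪ξ, Q.proj B η⟫_ℂ := by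
  rw [← ContinuousLinearMap.adjoint_inner_right, ← ContinuousLinearMap.star_eq_adjoint,
    (Q.isStarProjection B hB).isSelfAdjoint.star_eq]

theorem scalarMeasure_proj (hB : MeasurableSet B) (ξ : F) :
    Q.scalarMeasure (Q.proj B ξ) = (Q.scalarMeasure ξ).restrict B := by
  ext C hC
  rw [Measure.restrict_apply hC, Q.scalarMeasure_apply _ hC, Q.scalarMeasure_apply _ (hC.inter hB),
    Q.proj_proj hC hB]

theorem proj_add_compl (hB : MeasurableSet B) (ξ : F) : Q.proj B ξ + Q.proj Bᶜ ξ = ξ := by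
  let S : ℕ → Set ℝ := fun n => if n = 0 then B else if n = 1 then Bᶜ else ∅
  have hS : ∀ n, MeasurableSet (S n) := by
    rintro (_ | _ | n) <;> simp [S, hB]
  have hd : Pairwise (Function.onFun Disjoint S) := by
    rintro (_ | _ | m) (_ | _ | n) h <;>
      simp [S, Function.onFun, disjoint_compl_right, disjoint_compl_left] at h ⊢
  have hU : (⋃ n, S n) = Set.univ := by
    refine Set.eq_univ_of_forall fun x => Set.mem_iUnion.2 ?_
    by_cases hx : x ∈ B
    · exact ⟨0, by simpa [S] using hx⟩
    · exact ⟨1, by simpa [S] using hx⟩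
  have h1 := Q.hasSum_iUnion S hS hd ξ
  rw [hU, Q.proj_univ] at h1
  have h2 : HasSum (fun n => Q.proj (S n) ξ) (∑ n ∈ Finset.range 2, Q.proj (S n) ξ) := by
    refine hasSum_sum_of_ne_finset_zero fun n hn => ?_
    have h : ¬ n < 2 := by simpa using hn
    have : S n = ∅ := by simp only [S]; rw [if_neg (by omega), if_neg (by omega)]
    rw [this, Q.proj_empty, zero_apply]
  have h3 := h2.unique h1
  simpa [Finset.sum_range_succ, S] using h3

theorem norm_sq_univ (ξ : F) : (Q.scalarMeasure ξ).real Set.univ = ‖ξ‖ ^ 2 := by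
  rw [Q.scalarMeasure_real ξ MeasurableSet.univ, Q.proj_univ]; rfl

namespace IsSpectralMeasureOf

variable {Q}

theorem memLp (hQ : Q.IsSpectralMeasureOf A) {ξ y : F} (h : (ξ, y) ∈ A.graph) :
    MemLp (fun x : ℝ => x) 2 (Q.scalarMeasure ξ) :=
  (memLp_two_iff_integrable_sq measurable_id.aestronglyMeasurable).2
    ((hQ.1 ξ).1 (LinearPMap.mem_domain_of_mem_graph h))

theorem integrable_id (hQ : Q.IsSpectralMeasureOf A) {ξ y : F} (h : (ξ, y) ∈ A.graph) :
    Integrable (fun x : ℝ => x) (Q.scalarMeasure ξ) :=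
  (hQ.memLp h).integrable one_le_two

theorem inner_eq (hQ : Q.IsSpectralMeasureOf A) {ξ y : F} (h : (ξ, y) ∈ A.graph) :
    ⟪ξ, y⟫_ℂ = ((∫ x, x ∂Q.scalarMeasure ξ : ℝ) : ℂ) := by
  obtain ⟨hx, rfl⟩ := LinearPMap.mem_domain_of_graph h
  exact hQ.2 ⟨ξ, hx⟩

theorem exists_graph (hQ : Q.IsSpectralMeasureOf A) {ξ : F}
    (h : Integrable (fun x : ℝ => x ^ 2) (Q.scalarMeasure ξ)) : ∃ y, (ξ, y) ∈ A.graph :=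
  LinearPMap.mem_domain_iff.1 ((hQ.1 ξ).2 h)

theorem exists_graph_proj (hQ : Q.IsSpectralMeasureOf A) (hB : MeasurableSet B) {ξ y : F}
    (h : (ξ, y) ∈ A.graph) : ∃ z, (Q.proj B ξ, z) ∈ A.graph := by
  refine hQ.exists_graph ?_
  rw [Q.scalarMeasure_proj hB]
  exact ((hQ.1 ξ).1 (LinearPMap.mem_domain_of_mem_graph h)).restrict

/-- `A` maps the range of `Q(Bᶜ)` to the orthogonal complement of the range of `Q(B)`. -/
theorem inner_eq_zero (hQ : Q.IsSpectralMeasureOf A) (hB : MeasurableSet B) {u y v z : F}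
    (hu : (u, y) ∈ A.graph) (hv : (v, z) ∈ A.graph) (huB : Q.proj B u = u)
    (hvB : Q.proj B v = 0) : ⟪u, z⟫_ℂ = 0 := by
  -- The scalar measures of `u` and `v` add, so the quadratic form is additive and its cross terms
  -- cancel. Replacing `v` by `iv` then separates the two terms.
  have key : ∀ v z, (v, z) ∈ A.graph → Q.proj B v = 0 → ⟪u, z⟫_ℂ + ⟪v, y⟫_ℂ = 0 := by
    intro v z hv hvB
    have e1 : Q.proj B (u + v) = u := by rw [map_add, huB, hvB, add_zero]
    have e2 : Q.proj Bᶜ (u + v) = v := by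
      have := Q.proj_add_compl hB (u + v)
      rwa [e1, add_right_inj] at this
    have e3 : Q.scalarMeasure (u + v) = Q.scalarMeasure u + Q.scalarMeasure v := by
      rw [← Measure.restrict_add_restrict_compl (μ := Q.scalarMeasure (u + v)) hB,
        ← Q.scalarMeasure_proj hB, ← Q.scalarMeasure_proj hB.compl, e1, e2]
    have e4 : ⟪u + v, y + z⟫_ℂ = _ := hQ.inner_eq (A.graph.add_mem hu hv)
    rw [e3, integral_add_measure (hQ.integrable_id hu) (hQ.integrable_id hv), Complex.ofReal_add,
      ← hQ.inner_eq hu, ← hQ.inner_eq hv] at e4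
    simp only [inner_add_left, inner_add_right] at e4
    linear_combination e4
  have h1 := key v z hv hvB
  have h2 := key (Complex.I • v) (Complex.I • z) (A.graph.smul_mem Complex.I hv)
    (by rw [map_smul, hvB, smul_zero])
  rw [inner_smul_left, inner_smul_right, Complex.conj_I] at h2
  have h3 : Complex.I * (⟪u, z⟫_ℂ - ⟪v, y⟫_ℂ) = 0 := by linear_combination h2
  have h4 := (mul_eq_zero.1 h3).resolve_left Complex.I_ne_zero
  linear_combination (h1 + h4) / 2

/-- Spectral projections commute with the operator. -/
theorem proj_graph (hQ : Q.IsSpectralMeasureOf A) (hd : Dense (A.domain : Set F))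
    (hB : MeasurableSet B) {ξ y : F} (h : (ξ, y) ∈ A.graph) :
    (Q.proj B ξ, Q.proj B y) ∈ A.graph := by
  have key : ∀ {B : Set ℝ}, MeasurableSet B → ∀ {z}, (Q.proj Bᶜ ξ, z) ∈ A.graph →
      Q.proj B z = 0 := by
    intro B hB z hz
    refine hd.eq_zero_of_inner_right (𝕜 := ℂ) fun η hη => ?_
    obtain ⟨w, hw⟩ := LinearPMap.mem_domain_iff.1 hη
    obtain ⟨w', hw'⟩ := hQ.exists_graph_proj hB hw
    rw [← Q.inner_proj hB]
    refine hQ.inner_eq_zero hB hw' hz ?_ ?_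
    · rw [Q.proj_proj hB hB, Set.inter_self]
    · rw [Q.proj_proj hB hB.compl, Set.inter_compl_self, Q.proj_empty, zero_apply]
  obtain ⟨y1, h1⟩ := hQ.exists_graph_proj hB h
  obtain ⟨y2, h2⟩ := hQ.exists_graph_proj hB.compl h
  have e1 : Q.proj B y2 = 0 := key hB h2
  have e2 : Q.proj Bᶜ y1 = 0 := key hB.compl (by rwa [compl_compl])
  have e3 : y = y1 + y2 := A.mem_graph_snd_inj h (A.graph.add_mem h1 h2)
    (Q.proj_add_compl hB ξ).symm
  have e4 := Q.proj_add_compl hB y1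
  rw [e2, add_zero] at e4
  rwa [e3, map_add, e1, add_zero, e4]

theorem inner_proj_eq (hQ : Q.IsSpectralMeasureOf A) (hd : Dense (A.domain : Set F))
    (hB : MeasurableSet B) {ξ y : F} (h : (ξ, y) ∈ A.graph) :
    ⟪Q.proj B ξ, Q.proj B y⟫_ℂ = ((∫ x in B, x ∂Q.scalarMeasure ξ : ℝ) : ℂ) := by
  rw [hQ.inner_eq (hQ.proj_graph hd hB h), Q.scalarMeasure_proj hB]

/-- The spectral measure of a positive operator lives on `[0, ∞)`. -/
theorem proj_Iio_zero (hQ : Q.IsSpectralMeasureOf A) (hd : Dense (A.domain : Set F))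
    (hpos : ∀ x y, (x, y) ∈ A.graph → 0 ≤ (⟪x, y⟫_ℂ).re) : Q.proj (Set.Iio 0) = 0 := by
  have hm : MeasurableSet (Set.Iio (0 : ℝ)) := measurableSet_Iio
  refine ContinuousLinearMap.ext fun ξ => congrFun (Continuous.ext_on hd
    (Q.proj (Set.Iio 0)).continuous continuous_zero fun ξ hξ => ?_) ξ
  obtain ⟨y, h⟩ := LinearPMap.mem_domain_iff.1 hξ
  -- Positivity at `Q(Iio 0) ξ` gives `∫_{x<0} x ‖Q(dx)ξ‖² ≥ 0`, which forces the measure of `Iio 0`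
  -- to vanish.
  have h1 := hpos _ _ (hQ.proj_graph hd hm h)
  rw [hQ.inner_proj_eq hd hm h, Complex.ofReal_re] at h1
  have h2 : ∀ᵐ x ∂(Q.scalarMeasure ξ).restrict (Set.Iio 0), x < 0 := ae_restrict_mem hm
  have h3 : 0 ≤ᵐ[(Q.scalarMeasure ξ).restrict (Set.Iio 0)] fun x : ℝ => -x := by
    filter_upwards [h2] with x hx
    exact neg_nonneg.2 hx.le
  have h4 := (integral_eq_zero_iff_of_nonneg_ae h3 (hQ.integrable_id h).restrict.neg).1
    (le_antisymm (by rw [integral_neg]; linarith) (integral_nonneg_of_ae h3))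
  have h5 : ∀ᵐ x ∂(Q.scalarMeasure ξ).restrict (Set.Iio 0), False := by
    filter_upwards [h2, h4] with x hx hx'
    simp only [Pi.zero_apply, neg_eq_zero] at hx'
    exact hx.ne hx'
  have h6 : (Q.scalarMeasure ξ) (Set.Iio 0) = 0 := by
    rw [← Measure.restrict_eq_zero, ← ae_eq_bot]
    exact eventually_false_iff_eq_bot.1 h5
  have h7 := Q.scalarMeasure_real ξ hm
  rw [measureReal_def, h6, ENNReal.toReal_zero] at h7
  exact norm_eq_zero.1 ((pow_eq_zero_iff two_ne_zero).1 h7.symm)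

theorem ae_nonneg (h0 : Q.proj (Set.Iio 0) = 0) (ξ : F) :
    ∀ᵐ x ∂Q.scalarMeasure ξ, 0 ≤ x := by
  rw [ae_iff]
  simp only [not_le]
  change Q.scalarMeasure ξ (Set.Iio 0) = 0
  rw [Q.scalarMeasure_apply ξ measurableSet_Iio, h0]
  simp

/-- The polarized identity `⟨y, Q(dx) ξ⟩ = x ‖Q(dx) ξ‖²` for `y = A ξ`. -/
theorem scalarMeasure_add (hQ : Q.IsSpectralMeasureOf A) (hd : Dense (A.domain : Set F))
    (h0 : Q.proj (Set.Iio 0) = 0) {ξ y : F} (h : (ξ, y) ∈ A.graph) :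
    Q.scalarMeasure (y + ξ) = Q.scalarMeasure (y - ξ) +
      (Q.scalarMeasure ξ).withDensity fun x => ENNReal.ofReal (4 * x) := by
  ext B hB
  have hnn : 0 ≤ᵐ[(Q.scalarMeasure ξ).restrict B] fun x : ℝ => 4 * x := by
    filter_upwards [ae_restrict_of_ae (ae_nonneg h0 ξ)] with x hx
    exact mul_nonneg zero_le_four hx
  rw [Measure.add_apply, withDensity_apply _ hB, Q.scalarMeasure_apply _ hB,
    Q.scalarMeasure_apply _ hB, ← ofReal_integral_eq_lintegral_ofReal
      ((hQ.integrable_id h).restrict.const_mul 4) hnn,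
    ← ENNReal.ofReal_add (sq_nonneg _) (integral_nonneg_of_ae hnn), integral_const_mul]
  congr 1
  have e := congrArg Complex.re (hQ.inner_proj_eq hd hB h)
  rw [Complex.ofReal_re, ← inner_conj_symm, Complex.conj_re] at e
  rw [← e, map_add, map_sub, @norm_add_sq ℂ, @norm_sub_sq ℂ]
  simp only [RCLike.re_to_complex]
  ring

/-- Bounded spectral support puts `y = Aξ` back in the domain, with `⟨ξ, Ay⟩ = ‖y‖²`. Comparing the
quadratic form at `y + ξ` and `y - ξ` by `scalarMeasure_add` gives `4‖y‖² = 4 ∫ x²`. -/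
theorem norm_sq_eq_integral_of_bounded (hQ : Q.IsSpectralMeasureOf A) (hA : IsSelfAdjoint A)
    (h0 : Q.proj (Set.Iio 0) = 0) {ξ y : F} (h : (ξ, y) ∈ A.graph) {n : ℝ}
    (hξ : Q.proj (Set.Iic n) ξ = ξ) : ‖y‖ ^ 2 = ∫ x, x ^ 2 ∂Q.scalarMeasure ξ := by
  have hd := hA.dense_domain
  have hm : MeasurableSet (Set.Iic n) := measurableSet_Iic
  have hy : Q.proj (Set.Iic n) y = y := by
    have := hQ.proj_graph hd hm h
    rw [hξ] at this
    exact A.mem_graph_snd_inj this h rfl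
  obtain ⟨z, hz⟩ : ∃ z, (y, z) ∈ A.graph := by
    refine hQ.exists_graph ?_
    refine Integrable.of_bound (C := n ^ 2) (by fun_prop) ?_
    have h1 : ∀ᵐ x ∂Q.scalarMeasure y, x ≤ n := by
      rw [← hy, Q.scalarMeasure_proj hm]
      exact ae_restrict_mem hm
    filter_upwards [h1, ae_nonneg h0 y] with x hx hx0
    rw [Real.norm_eq_abs, abs_of_nonneg (sq_nonneg _)]
    exact pow_le_pow_left₀ hx0 hx 2
  have hadd : (y + ξ, z + y) ∈ A.graph := A.graph.add_mem hz h
  have hsub : (y - ξ, z - y) ∈ A.graph := A.graph.sub_mem hz h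
  have hmeas := hQ.scalarMeasure_add hd h0 h
  have hi : Integrable (fun x : ℝ => x)
      ((Q.scalarMeasure ξ).withDensity fun x => ENNReal.ofReal (4 * x)) :=
    (hQ.integrable_id hadd).mono_measure (by rw [hmeas]; exact Measure.le_add_left le_rfl)
  have e1 : (⟪y + ξ, z + y⟫_ℂ).re = (⟪y - ξ, z - y⟫_ℂ).re +
      4 * ∫ x, x ^ 2 ∂Q.scalarMeasure ξ := by
    rw [hQ.inner_eq hadd, hQ.inner_eq hsub, Complex.ofReal_re, Complex.ofReal_re, hmeas,
      integral_add_measure (hQ.integrable_id hsub) hi,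
      integral_withDensity_eq_integral_toReal_smul (by fun_prop)
        (ae_of_all _ fun _ => ENNReal.ofReal_lt_top), ← integral_const_mul]
    congr 1
    refine integral_congr_ae ?_
    filter_upwards [ae_nonneg h0 ξ] with x hx
    rw [ENNReal.toReal_ofReal (by positivity), smul_eq_mul]
    ring
  have e2 : ⟪ξ, z⟫_ℂ = ⟪y, y⟫_ℂ := (hA.inner_graph h hz).symm
  have e3 : (⟪y, y⟫_ℂ).re = ‖y‖ ^ 2 := inner_self_eq_norm_sq (𝕜 := ℂ) y
  simp only [inner_add_left, inner_add_right, inner_sub_left, inner_sub_right, Complex.add_re,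
    Complex.sub_re, e2, e3] at e1
  linarith

/-- `‖A ξ‖² = ∫ x² ‖Q(dx) ξ‖²`. -/
theorem norm_sq_eq_integral (hQ : Q.IsSpectralMeasureOf A) (hA : IsSelfAdjoint A)
    (h0 : Q.proj (Set.Iio 0) = 0) {ξ y : F} (h : (ξ, y) ∈ A.graph) :
    ‖y‖ ^ 2 = ∫ x, x ^ 2 ∂Q.scalarMeasure ξ := by
  have hd := hA.dense_domain
  have hm : ∀ n : ℕ, MeasurableSet (Set.Iic (n : ℝ)) := fun n => measurableSet_Iic
  have hmono : Monotone fun n : ℕ => Set.Iic (n : ℝ) := fun m n hmn =>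
    Set.Iic_subset_Iic.2 (by exact_mod_cast hmn)
  have hU : (⋃ n : ℕ, Set.Iic (n : ℝ)) = Set.univ := Set.eq_univ_of_forall fun x =>
    Set.mem_iUnion.2 (exists_nat_ge x)
  -- The bounded case applies to `Q(Iic n) ξ`; then `n → ∞`.
  have h1 : ∀ n : ℕ, (Q.scalarMeasure y).real (Set.Iic (n : ℝ)) =
      ∫ x in Set.Iic (n : ℝ), x ^ 2 ∂Q.scalarMeasure ξ := by
    intro n
    rw [Q.scalarMeasure_real y (hm n), hQ.norm_sq_eq_integral_of_bounded hA h0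
      (hQ.proj_graph hd (hm n) h) (n := n) (by rw [Q.proj_proj (hm n) (hm n), Set.inter_self]),
      Q.scalarMeasure_proj (hm n)]
  have h2 : Tendsto (fun n : ℕ => (Q.scalarMeasure y).real (Set.Iic (n : ℝ))) atTop
      (𝓝 (‖y‖ ^ 2)) := by
    rw [← Q.norm_sq_univ y, ← hU]
    exact (ENNReal.tendsto_toReal (measure_ne_top _ _)).comp (tendsto_measure_iUnion_atTop hmono)
  have h3 := tendsto_setIntegral_of_monotone (f := fun x : ℝ => x ^ 2) (μ := Q.scalarMeasure ξ)
    hm hmono (by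
      rw [hU, integrableOn_univ]
      exact (hQ.1 ξ).1 (LinearPMap.mem_domain_of_mem_graph h))
  rw [hU, setIntegral_univ] at h3
  simp only [h1] at h2
  exact tendsto_nhds_unique h2 h3

/-- `‖Q(dx) (α + A) ξ‖² = (α + x)² ‖Q(dx) ξ‖²`. -/
theorem scalarMeasure_shift (hQ : Q.IsSpectralMeasureOf A) (hA : IsSelfAdjoint A)
    (h0 : Q.proj (Set.Iio 0) = 0) {ξ y : F} (h : (ξ, y) ∈ A.graph) (α : ℝ) :
    Q.scalarMeasure ((α : ℂ) • ξ + y) =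
      (Q.scalarMeasure ξ).withDensity fun x => ENNReal.ofReal ((α + x) ^ 2) := by
  have hi1 := hQ.integrable_id h
  have hi2 := (hQ.1 ξ).1 (LinearPMap.mem_domain_of_mem_graph h)
  have hexp : (fun x : ℝ => (α + x) ^ 2) = fun x => α ^ 2 + 2 * α * x + x ^ 2 := by
    ext x; ring
  have hi : Integrable (fun x : ℝ => (α + x) ^ 2) (Q.scalarMeasure ξ) := by
    rw [hexp]; exact ((integrable_const _).add (hi1.const_mul _)).add hi2
  ext B hB
  rw [withDensity_apply _ hB, Q.scalarMeasure_apply _ hB, ← ofReal_integral_eq_lintegral_ofReal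
    hi.restrict (ae_of_all _ fun x => sq_nonneg _)]
  congr 1
  have e1 := hQ.norm_sq_eq_integral hA h0 (hQ.proj_graph hA.dense_domain hB h)
  rw [Q.scalarMeasure_proj hB] at e1
  have e2 := congrArg Complex.re (hQ.inner_proj_eq hA.dense_domain hB h)
  rw [Complex.ofReal_re] at e2
  have e3 : ∫ x in B, (α ^ 2 + 2 * α * x + x ^ 2) ∂Q.scalarMeasure ξ =
      (∫ x in B, (α ^ 2 + 2 * α * x) ∂Q.scalarMeasure ξ) + ∫ x in B, x ^ 2 ∂Q.scalarMeasure ξ :=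
    integral_add ((integrable_const _).add (hi1.restrict.const_mul _)) hi2.restrict
  rw [hexp, e3, integral_add (integrable_const _) (hi1.restrict.const_mul _), integral_const_mul,
    ← e1, ← e2,
    setIntegral_const, Q.scalarMeasure_real ξ hB, map_add, map_smul, @norm_add_sq ℂ, norm_smul,
    inner_smul_left, Complex.conj_ofReal, mul_pow, Complex.norm_real, Real.norm_eq_abs, sq_abs,
    RCLike.re_to_complex, Complex.re_ofReal_mul, smul_eq_mul]
  ring

/-- Integrals with respect to `‖Q(dx) (α + A) ξ‖²` over `[0, ∞)`. -/
theorem integral_shift (hQ : Q.IsSpectralMeasureOf A) (hA : IsSelfAdjoint A)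
    (h0 : Q.proj (Set.Iio 0) = 0) {ξ y : F} (h : (ξ, y) ∈ A.graph) {α : ℝ} {f g : ℝ → ℝ}
    (hfg : ∀ x, 0 ≤ x → (α + x) ^ 2 * f x = g x) (hg : Integrable g (Q.scalarMeasure ξ)) :
    IntegrableOn f (Set.Ici 0) (Q.scalarMeasure ((α : ℂ) • ξ + y)) ∧
      ∫ x in Set.Ici 0, f x ∂Q.scalarMeasure ((α : ℂ) • ξ + y) =
        ∫ x, g x ∂Q.scalarMeasure ξ := by
  have hae : (fun x => (ENNReal.ofReal ((α + x) ^ 2)).toReal • f x) =ᵐ[Q.scalarMeasure ξ] g := by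
    filter_upwards [ae_nonneg h0 ξ] with x hx
    rw [ENNReal.toReal_ofReal (sq_nonneg _), smul_eq_mul, hfg x hx]
  rw [IntegrableOn, Measure.restrict_eq_self_of_ae_mem (s := Set.Ici (0 : ℝ)) (ae_nonneg h0 _),
    hQ.scalarMeasure_shift hA h0 h]
  have hm : Measurable fun x : ℝ => ENNReal.ofReal ((α + x) ^ 2) := by fun_prop
  refine ⟨?_, ?_⟩
  · rw [integrable_withDensity_iff_integrable_smul' hm (by simp)]
    exact hg.congr hae.symm
  · rw [integral_withDensity_eq_integral_toReal_smul hm (by simp)]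
    exact integral_congr_ae hae

end IsSpectralMeasureOf

end ProjectionMeasure

end SpectralMeasures

/-! ### The regularized solution `T*(α + T T*)⁻¹ φ` -/

section Regularization

variable {E F : Type*} [NormedAddCommGroup E] [InnerProductSpace ℂ E] [NormedAddCommGroup F]
  [InnerProductSpace ℂ F] {T : E →ₗ.[ℂ] F}

theorem weightedNormSq_graphOp {α : ℝ} {f u : E} {y : F} (h : (f, y) ∈ T.graph) (hu : u = f)
    (hud : u ∈ (graphOp T).domain) :
    weightedNormSq α (graphOp T ⟨u, hud⟩) = α * ‖f‖ ^ 2 + ‖y‖ ^ 2 := by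
  subst hu
  obtain ⟨hd, rfl⟩ := LinearPMap.mem_domain_of_graph h
  change ((α : ℂ) * ⟪u, u⟫_ℂ + ⟪T ⟨u, hd⟩, T ⟨u, hd⟩⟫_ℂ).re = _
  rw [Complex.add_re, Complex.re_ofReal_mul]
  congr 2
  · exact inner_self_eq_norm_sq (𝕜 := ℂ) _
  · exact inner_self_eq_norm_sq (𝕜 := ℂ) _

variable [CompleteSpace E] [CompleteSpace F]

/-- For `S ≥ 0` with `S² = A`, one has `‖S x‖² = ⟨x, A x⟩` on the domain of `A`. -/
theorem IsPositiveSqrt.norm_sq_eq {S A : F →ₗ.[ℂ] F} (hS : IsPositiveSqrt S A) {x y : F}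
    (h : (x, y) ∈ A.graph) : ∃ z, (x, z) ∈ S.graph ∧ ‖z‖ ^ 2 = (⟪x, y⟫_ℂ).re := by
  rw [← hS.2.2] at h
  obtain ⟨z, h1, h2⟩ := mem_graph_opComp.1 h
  exact ⟨z, h1, by rw [← hS.1.inner_graph h1 h2]; exact (inner_self_eq_norm_sq (𝕜 := ℂ) z).symm⟩

end Regularization

theorem lemma3p1 {X : Type*} [MeasurableSpace X]
    {H : Type*} [NormedAddCommGroup H] [InnerProductSpace ℂ H] [CompleteSpace H] [RKHS ℂ H X ℂ]
    {K : X → X → ℂ} (hK : HasKernel H K) {μ : Measure X} (hadm : Admissible hK μ)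
    {α : ℝ} (hα : 0 < α) :
    -- `T T*` is self-adjoint, has a spectral measure and a positive square root
    IsSelfAdjoint (opTTStar hadm.op) ∧
    (∃ Q : ProjectionMeasure (Lp ℂ 2 μ), Q.IsSpectralMeasureOf (opTTStar hadm.op)) ∧
    (∃ S, IsPositiveSqrt S (opTTStar hadm.op)) ∧
    -- `α + T T*` is a bijection of the domain of `T T*` onto `L²(μ)`
    Function.Bijective (opShift α (opTTStar hadm.op)) ∧
    -- every spectral measure of `T T*` lives on `[0, ∞)`
    (∀ Q : ProjectionMeasure (Lp ℂ 2 μ), Q.IsSpectralMeasureOf (opTTStar hadm.op) →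
      Q.proj (Set.Iio 0) = 0) ∧
    -- `f = T* (α + T T*)⁻¹ φ` is defined, and lies in the domain of `T`, which is that of `W`
    ∀ φ : Lp ℂ 2 μ, ∃ (hf : φ ∈ (featureOp hadm.op α).domain)
      (hW : featureOp hadm.op α ⟨φ, hf⟩ ∈ (graphOp hadm.op).domain),
      (∃ h : φ ∈ (opComp (opTTStar hadm.op) (opComp (opResolvent α (opTTStar hadm.op))
          (opResolvent α (opTTStar hadm.op)))).domain,
        ((‖featureOp hadm.op α ⟨φ, hf⟩‖ ^ 2 : ℝ) : ℂ) =
          ⟪φ, opComp (opTTStar hadm.op) (opComp (opResolvent α (opTTStar hadm.op))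
            (opResolvent α (opTTStar hadm.op))) ⟨φ, h⟩⟫_ℂ) ∧
      (∀ S, IsPositiveSqrt S (opTTStar hadm.op) →
        ∃ h : φ ∈ (opComp S (opResolvent α (opTTStar hadm.op))).domain,
          ‖featureOp hadm.op α ⟨φ, hf⟩‖ ^ 2 =
            ‖opComp S (opResolvent α (opTTStar hadm.op)) ⟨φ, h⟩‖ ^ 2) ∧
      (∀ Q : ProjectionMeasure (Lp ℂ 2 μ), Q.IsSpectralMeasureOf (opTTStar hadm.op) →
        IntegrableOn (fun x : ℝ => x / (α + x) ^ 2) (Set.Ici 0) (Q.scalarMeasure φ) ∧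
        ‖featureOp hadm.op α ⟨φ, hf⟩‖ ^ 2 =
          ∫ x in Set.Ici (0 : ℝ), x / (α + x) ^ 2 ∂Q.scalarMeasure φ ∧
        IntegrableOn (fun x : ℝ => x / (α + x)) (Set.Ici 0) (Q.scalarMeasure φ) ∧
        weightedNormSq α (graphOp hadm.op ⟨featureOp hadm.op α ⟨φ, hf⟩, hW⟩) =
          ∫ x in Set.Ici (0 : ℝ), x / (α + x) ∂Q.scalarMeasure φ) ∧
      weightedNormSq α (graphOp hadm.op ⟨featureOp hadm.op α ⟨φ, hf⟩, hW⟩) ≤ ‖φ‖ ^ 2 := by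
  have hT := hadm.dense_domain
  have hc := hadm.isClosed
  have hA := isSelfAdjoint_opTTStar hT hc
  have hpos := opTTStar_pos hT
  have hsurj := fun φ => exists_mem_graph_opTTStar hT hc hα φ
  have hbij := opShift_bijective hpos hα hsurj
  obtain ⟨R, hR0, hR1, hAR⟩ := exists_resolvent (opTTStar_symm hT) hpos
    (exists_mem_graph_opTTStar hT hc one_pos)
  have hproj : ∀ Q : ProjectionMeasure (Lp ℂ 2 μ), Q.IsSpectralMeasureOf (opTTStar hadm.op) →
      Q.proj (Set.Iio 0) = 0 := fun Q hQ => hQ.proj_Iio_zero hA.dense_domain hpos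
  refine ⟨hA, exists_isSpectralMeasureOf hR0 hR1 hAR hA,
    exists_isPositiveSqrt hR0 hR1 hAR hA.dense_domain, hbij, hproj, fun φ => ?_⟩
  -- The kernel plays no further role: only the facts about `T` collected above are used.
  generalize hadm.op = T at *
  have hres : ∀ {x z : Lp ℂ 2 μ}, (z, x) ∈ (opResolvent α (opTTStar T)).graph ↔
      (x, z - (α : ℂ) • x) ∈ (opTTStar T).graph := mem_graph_opResolvent hbij.1
  obtain ⟨ψ, hψ⟩ := hsurj φ
  obtain ⟨f, hψf, hfy⟩ := mem_graph_opTTStar.1 hψ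
  have hφ : φ = (α : ℂ) • ψ + (φ - (α : ℂ) • ψ) := (add_sub_cancel _ _).symm
  set y := φ - (α : ℂ) • ψ with hy
  have hφf : (φ, f) ∈ (featureOp T α).graph := mem_graph_opComp.2 ⟨ψ, hres.2 hψ, hψf⟩
  obtain ⟨hf, hfeq⟩ := LinearPMap.mem_domain_of_graph hφf
  have hfdom : featureOp T α ⟨φ, hf⟩ ∈ (graphOp T).domain := by
    rw [hfeq]; exact (LinearPMap.mem_domain_of_graph hfy).1
  have hff : ⟪ψ, y⟫_ℂ = ((‖f‖ ^ 2 : ℝ) : ℂ) := by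
    rw [(inner_opTTStar hT hψf hfy hψf hfy).1, inner_self_eq_norm_sq_to_K]
    norm_cast
  have hff' : (⟪ψ, y⟫_ℂ).re = ‖f‖ ^ 2 := by rw [hff, Complex.ofReal_re]
  have hW := weightedNormSq_graphOp (α := α) hfy hfeq hfdom
  refine ⟨hf, hfdom, ?_, fun S hS => ?_, fun Q hQ => ?_, ?_⟩
  -- `χ = (α + A)⁻¹ψ`, so `A(α + A)⁻²φ = Aχ = ψ - αχ`. Symmetry gives `⟨φ, Aχ⟩ = ⟨ψ, (α + A)Aχ⟩ =
  -- ⟨ψ, Aψ⟩` formally; the code uses only `⟨Aψ, χ⟩ = ⟨ψ, Aχ⟩`, without needing `Aχ` in the domain.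
  · obtain ⟨χ, hχ⟩ := hsurj ψ
    have h2 : (φ, ψ - (α : ℂ) • χ) ∈ (opComp (opTTStar T) (opComp (opResolvent α (opTTStar T))
        (opResolvent α (opTTStar T)))).graph :=
      mem_graph_opComp.2 ⟨χ, mem_graph_opComp.2 ⟨ψ, hres.2 hψ, hres.2 hχ⟩, hχ⟩
    obtain ⟨hd, he⟩ := LinearPMap.mem_domain_of_graph h2
    refine ⟨hd, ?_⟩
    have e1 := hA.inner_graph hψ hχ
    have e2 : ⟪y, ψ⟫_ℂ = ⟪ψ, y⟫_ℂ := hA.inner_graph hψ hψ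
    rw [he, hfeq, ← hff, hφ]
    simp only [inner_add_left, inner_sub_right, inner_smul_left, inner_smul_right,
      Complex.conj_ofReal] at e1 ⊢
    linear_combination (α : ℂ) * e1 - e2
  · obtain ⟨z, hz, hzn⟩ := hS.norm_sq_eq hψ
    obtain ⟨hd, he⟩ := LinearPMap.mem_domain_of_graph
      (mem_graph_opComp.2 ⟨ψ, hres.2 hψ, hz⟩ : (φ, z) ∈ (opComp S (opResolvent α (opTTStar T))).graph)
    exact ⟨hd, by rw [he, hfeq, hzn, hff']⟩
  · have hi1 := hQ.integrable_id hψ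
    have hi2 := (hQ.1 ψ).1 (LinearPMap.mem_domain_of_mem_graph hψ)
    have hq : ∫ x, x ∂Q.scalarMeasure ψ = ‖f‖ ^ 2 := by
      rw [← hff', hQ.inner_eq hψ, Complex.ofReal_re]
    have hne : ∀ x : ℝ, 0 ≤ x → α + x ≠ 0 := fun x hx => by positivity
    have e1 : ∀ x : ℝ, 0 ≤ x → (α + x) ^ 2 * (x / (α + x) ^ 2) = x := fun x hx =>
      mul_div_cancel₀ x (pow_ne_zero 2 (hne x hx))
    have e2 : ∀ x : ℝ, 0 ≤ x → (α + x) ^ 2 * (x / (α + x)) = α * x + x ^ 2 := fun x hx => by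
      have := hne x hx
      field_simp
    have i1 := hQ.integral_shift hA (hproj Q hQ) hψ e1 hi1
    have i2 := hQ.integral_shift hA (hproj Q hQ) hψ e2 ((hi1.const_mul α).add hi2)
    rw [← hφ] at i1 i2
    refine ⟨i1.1, ?_, i2.1, ?_⟩
    · rw [i1.2, hfeq, hq]
    · rw [i2.2, hW, integral_add (hi1.const_mul α) hi2, integral_const_mul, hq,
        hQ.norm_sq_eq_integral hA (hproj Q hQ) hψ]
  · rw [hW]
    -- `‖φ‖² = α²‖ψ‖² + 2α‖f‖² + ‖y‖²` exceeds `α‖f‖² + ‖y‖²` by nonnegative terms.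
    conv_rhs => rw [hφ]
    rw [@norm_add_sq ℂ, norm_smul, inner_smul_left, Complex.conj_ofReal, RCLike.re_to_complex,
      Complex.re_ofReal_mul, hff']
    have h1 : 0 ≤ α * ‖f‖ ^ 2 := by positivity
    have h2 := sq_nonneg (‖(α : ℂ)‖ * ‖ψ‖)
    linarith
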